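/- For $n\ge 1$ let $G_1=G_1^{(n,n)}=\{(i,j): 1\le i,j\le n\}$ be the $n\times n$ square grid. Let $G_{1,T,R}$ be the multigraph with vertex set $G_1\cup\{T,R\}$ ($T$ the terminal, $R$ the root) obtained as follows: keep all edges of the square lattice $\mathbb Z^2$ having at least one end in $G_1$; among the lattice edges leaving $G_1$ at $(1,1)$ let exactly one, the one to $(0,1)$, lead to $T$, let every other lattice edge leaving $G_1$ lead to $R$ (possibly creating parallel edges), and add one edge $TR$. Thus every vertex of $G_1$ has degree exactly $4$. All edges have weight $1$. Let $\triangle f(v)=\sum_w c_{vw}(f(v)-f(w))$ be its Laplacian, $c_{vw}$ being the number of edges joining $v$ and $w$, and let $K$ be the restriction $1_{G_1}\triangle 1_{G_1}$ to $G_1$ (so $K=4I-\mathrm{Adj}(G_1)$). Then $K$ is invertible; put $A^{(n,n)}=K^{-1}$. (1) For all fixed integers $x,y\ge 1$, the integral below converges absolutely and $$\lim_{n\to\infty}A^{(n,n)}((x,y),(1,1))=\frac{2}{\pi^2}\iint_{(0,\pi)^2}\frac{\sin(\theta x)\sin(\phi y)\sin\theta\sin\phi}{2-\cos\theta-\cos\phi}\,d\theta\,d\phi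 .$$ (2) Choose uniformly at random a spanning tree of $G_{1,T,R}$ containing the edge $TR$ (equivalently, a spanning tree of the multigraph obtained by identifying $T$ with $R$). Let $l_T$ be the length of its TI-tree, the part of the tree attached to the root through the edge $TR$: that is, the number of vertices of $G_1$ connected to $T$ in the tree after the edge $TR$ is cut (equivalently, the number of edges of the TI-tree other than $TR$). Then for every $n\ge 1$ $$\mathbf E[l_T]=\sum_{(x,y)\in G_1}A^{(n,n)}((x,y),(1,1)),$$ and $\mathbf E[l_T]=\frac{2}{\pi}\log n\,(1+o(1))$ as $n\to\infty$. -/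

import Mathlib

open Real Set Filter Topology MeasureTheory
open scoped BigOperators Asymptotics

/-! ### Laplacian and trees for multigraphs -/

/-- The number of edges joining `v` and `w`: the weight `c_{vw}` when every edge has weight `1`. -/
noncomputable def edgeMultiplicity {α β : Type*} (G : Graph α β) (v w : α) : ℕ :=
  {e : β | G.IsLink e v w}.ncard

/-- The graph Laplacian `(Δ_G f)(v) = ∑_{w ∈ V(G)} c_{vw} (f v - f w)`, all edges having
weight `1` (parallel edges add up). -/
noncomputable def graphLaplacian {α β : Type*} (G : Graph α β) (f : α → ℝ) (v : α) : ℝ :=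
  ∑ᶠ w ∈ G.vertexSet, (edgeMultiplicity G v w : ℝ) * (f v - f w)

/-- There is a path from `u` to `v` in `G`. -/
def Graph.Reaches {α β : Type*} (G : Graph α β) (u v : α) : Prop :=
  Relation.ReflTransGen G.Adj u v

/-- A (multi)graph is a tree if it is nonempty, connected, and acyclic; acyclicity is expressed by
saying that every edge is a bridge (so there are neither loops nor pairs of parallel edges). -/
structure Graph.IsTree {α β : Type*} (G : Graph α β) : Prop where
  nonempty : G.vertexSet.Nonempty
  connected : ∀ u ∈ G.vertexSet, ∀ v ∈ G.vertexSet, G.Reaches u v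
  acyclic : ∀ e u v, G.IsLink e u v → ¬ (G.deleteEdges {e}).Reaches u v

/-- `F` is the edge set of a spanning tree of `G`. -/
def Graph.IsSpanningTree {α β : Type*} (G : Graph α β) (F : Set β) : Prop :=
  F ⊆ G.edgeSet ∧ (G.restrict F).IsTree

/-! ### The rectangle with one terminal -/

/-- The vertices `{(i, j) | 1 ≤ i ≤ n, 1 ≤ j ≤ m}` of `G₁`. -/
noncomputable def gridVertices (n m : ℕ) : Finset (ℤ × ℤ) :=
  Finset.Icc 1 (n : ℤ) ×ˢ Finset.Icc 1 (m : ℤ)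

/-- Nearest neighbours in the square lattice. -/
def LatticeAdj (p q : ℤ × ℤ) : Prop :=
  |p.1 - q.1| + |p.2 - q.2| = 1

/-- Vertices of `G_{1,T,R}`: lattice sites, the terminal `T` and the root `R`. -/
inductive GridVertex : Type
  | site (p : ℤ × ℤ)
  | terminal
  | root

open Classical in
/-- A site of the rectangle is itself; the outer lattice neighbour `(0,1)` of the corner `(1,1)`
is the terminal `T`; all other outer lattice sites are identified with the root `R`. -/
noncomputable def gridEndpoint (n m : ℕ) (p : ℤ × ℤ) : GridVertex :=
  if p ∈ gridVertices n m then .site p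
  else if p = (0, 1) then .terminal
  else .root

/-- The ends of an edge of `G_{1,T,R}`: the edge `none` joins `T` and `R`; the edges `some e` are
the lattice edges `e` with at least one end in the rectangle, their outer ends
being identified with `T` or `R` by `gridEndpoint`. -/
def GridLink (n m : ℕ) (e : Option (Sym2 (ℤ × ℤ))) (v w : GridVertex) : Prop :=
  (e = none ∧ ((v = .terminal ∧ w = .root) ∨ (v = .root ∧ w = .terminal))) ∨
  ∃ p q : ℤ × ℤ, e = some s(p, q) ∧ LatticeAdj p q ∧
    (p ∈ gridVertices n m ∨ q ∈ gridVertices n m) ∧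
    v = gridEndpoint n m p ∧ w = gridEndpoint n m q

/-- The multigraph `G_{1,T,R}` of the `n × m` rectangle with the terminal attached to `(1,1)`.
Every vertex of the rectangle has degree exactly `4`: the lattice edges leaving the rectangle are
kept, one of those at `(1,1)` leading to `T` and all the others to `R`
(so that several of them can be parallel). -/
def gridTR (n m : ℕ) : Graph GridVertex (Option (Sym2 (ℤ × ℤ))) where
  vertexSet := {v | (∃ p ∈ gridVertices n m, v = .site p) ∨ v = .terminal ∨ v = .root}
  IsLink := GridLink n m
  isLink_symm := by
    intro e _
    refine ⟨fun v w h => ?_⟩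
    rcases h with ⟨he, h⟩ | ⟨p, q, he, hpq, hg, hv, hw⟩
    · exact Or.inl ⟨he, by tauto⟩
    · refine Or.inr ⟨q, p, by rw [he, Sym2.eq_swap], ?_, hg.symm, hw, hv⟩
      unfold LatticeAdj at *
      rw [abs_sub_comm q.1, abs_sub_comm q.2, hpq]
  eq_or_eq_of_isLink_of_isLink := by
    rintro e x y v w (⟨he, h⟩ | ⟨p, q, he, -, -, hx, hy⟩) (⟨he', h'⟩ | ⟨p', q', he', -, -, hv, hw⟩)
    · grind
    · simp [he] at he'
    · simp [he] at he'
    · rw [he] at he'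
      rcases Sym2.eq_iff.1 (Option.some.inj he') with ⟨h, -⟩ | ⟨h, -⟩
      · left; rw [hx, hv, h]
      · right; rw [hx, hw, h]
  left_mem_of_isLink := by
    rintro e x y (⟨-, h⟩ | ⟨p, q, -, -, -, hx, -⟩)
    · grind
    · subst hx
      unfold gridEndpoint
      split_ifs with h1 h2
      · exact Or.inl ⟨p, h1, rfl⟩
      · exact Or.inr (Or.inl rfl)
      · exact Or.inr (Or.inr rfl)

/-- `K`, the Laplacian restricted to `G₁` (that is, `1_{G₁} Δ 1_{G₁}`), as a matrix:
`K(p, q) = (Δ δ_q)(p)`. -/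
noncomputable def gridK (n m : ℕ) :
    Matrix (gridVertices n m) (gridVertices n m) ℝ :=
  Matrix.of fun p q =>
    graphLaplacian (gridTR n m) (Set.indicator {GridVertex.site q} 1) (GridVertex.site p)

open Classical in
/-- The matrix elements `A^{(n,m)}(p, q)` of `A^{(n,m)} = K⁻¹` for sites `p, q` of the rectangle
(and `0`, by convention, if `p` or `q` is not in the rectangle). -/
noncomputable def gridA (n m : ℕ) (p q : ℤ × ℤ) : ℝ :=
  if h : p ∈ gridVertices n m ∧ q ∈ gridVertices n m then
    (gridK n m)⁻¹ ⟨p, h.1⟩ ⟨q, h.2⟩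
  else 0

/-- The spanning trees of `G_{1,T,R}` occurring in the generalized Temperley bijection for one
impurity: those containing the edge `TR`, i.e. consisting of one TI-tree (the part hanging from the
root by the edge `TR`) and IO-trees (the parts hanging from the root by other edges), without
TO-tree. They are in bijection with the spanning trees of the graph `G_{1,R}` in which `T` is
identified with `R`. -/
def tiSpanningTrees (n m : ℕ) : Set (Set (Option (Sym2 (ℤ × ℤ)))) :=
  {F | (gridTR n m).IsSpanningTree F ∧ none ∈ F}

/-- The length `l_T` of the TI-tree of the spanning tree with edge set `F`: the number of vertices
of `G₁` which are connected to `T` once the edge `TR` is cut. This is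
also the number of edges of the TI-tree, not counting the edge `TR`. -/
noncomputable def tiLength (n m : ℕ) (F : Set (Option (Sym2 (ℤ × ℤ)))) : ℕ :=
  {p : ℤ × ℤ | p ∈ gridVertices n m ∧
    (((gridTR n m).restrict F).deleteEdges {none}).Reaches .terminal (.site p)}.ncard

/-- `E[l_T]`, the expectation for the uniform distribution on the (finite) set of spanning
trees. -/
noncomputable def expectedTILength (n m : ℕ) : ℝ :=
  (∑ᶠ F ∈ tiSpanningTrees n m, (tiLength n m F : ℝ)) / ((tiSpanningTrees n m).ncard : ℝ)

/-- The integrand `sin(θx) sin(φy) sin θ sin φ / (2 - cos θ - cos φ)`, at `z = (θ, φ)`. -/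
noncomputable def greenIntegrand (x y : ℤ) (z : ℝ × ℝ) : ℝ :=
  Real.sin (z.1 * x) * Real.sin (z.2 * y) * Real.sin z.1 * Real.sin z.2 /
    (2 - Real.cos z.1 - Real.cos z.2)

/-! ### Connectivity by a set of edges -/

/-! The combinatorial half. For a vertex v let N(v) be the number of admissible trees whose TI-tree
contains v; it equals the number of trees at T and 0 at R. At a site p, consider pairs (neighbour q
of p, tree F). If q is not a descendant of p, replace the parent edge of p by pq and record the old
parent; otherwise change nothing. This is an involution carrying "p lies in the TI-tree" to "the
recorded neighbour lies in the TI-tree" (`reroot`, `tiCount_harmonic`), so N is harmonic on the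
grid. Hence K applied to N is the number of trees times the delta function at (1,1), and E[l_T] is a
column sum of the inverse of K (`expectedTILength_eq_sum_gridA`).

The analytic half. Products of sines diagonalize K (`gridK_mul_gridGreen`), which gives
invertibility and an explicit Green function. Its entries are Riemann sums of an integrand that is
continuous up to the boundary, whence the limit (`tendsto_gridA`). Summing over all sites kills the
even frequencies (`sum_gridA`). The remaining double sum is, up to O(1), 16/π² times the sum of
1/((2i+1)²+(2j+1)²). An arctangent comparison turns each inner sum into π/(4(2i+1)), and the odd
harmonic sum is (log n)/2 + O(1); the constant is 16/π² · π/4 · 1/2 = 2/π. -/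

namespace Graph

variable {α β : Type*} {G : Graph α β} {F F' : Set β} {u v w a b c d r s t : α} {e f g o : β}

/-- The vertices `u` and `v` are joined by a path using only edges of `F`. -/
def JoinedBy (G : Graph α β) (F : Set β) (u v : α) : Prop :=
  (G.restrict F).Reaches u v

lemma reaches_deleteEdges_restrict {S : Set β} :
    ((G.restrict F).deleteEdges S).Reaches u v ↔ G.JoinedBy (F \ S) u v := by
  have h : ((G.restrict F).deleteEdges S).Adj = (G.restrict (F \ S)).Adj := by
    ext x y
    simp only [Adj, deleteEdges_isLink, restrict_isLink, Set.mem_sdiff]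
    exact exists_congr fun e => by tauto
  rw [JoinedBy, Reaches, Reaches, h]

namespace JoinedBy

lemma refl (u : α) : G.JoinedBy F u u := Relation.ReflTransGen.refl

lemma trans (h : G.JoinedBy F u v) (h' : G.JoinedBy F v w) : G.JoinedBy F u w :=
  Relation.ReflTransGen.trans h h'

lemma of_isLink (he : e ∈ F) (h : G.IsLink e u v) : G.JoinedBy F u v :=
  Relation.ReflTransGen.single ⟨e, he, h⟩

lemma symm (h : G.JoinedBy F u v) : G.JoinedBy F v u := by
  induction h with
  | refl => exact refl _
  | tail _ h ih =>
    obtain ⟨e, he, h⟩ := h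
    exact (of_isLink he h.symm).trans ih

lemma mono (hF : F ⊆ F') (h : G.JoinedBy F u v) : G.JoinedBy F' u v :=
  Relation.ReflTransGen.mono (fun _ _ ⟨e, he, h⟩ => ⟨e, hF he, h⟩) _ _ h

lemma of_links (hF : ∀ e ∈ F, ∀ x y, G.IsLink e x y → G.JoinedBy F' x y)
    (h : G.JoinedBy F u v) : G.JoinedBy F' u v := by
  induction h with
  | refl => exact refl _
  | tail _ h ih =>
    obtain ⟨e, he, h⟩ := h
    exact ih.trans (hF e he _ _ h)

/-- A walk crossing `f` more than once can be short-circuited, so only zero or one crossing matters,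
in either direction. -/
lemma insert_iff (hf : G.IsLink f a b) :
    G.JoinedBy (insert f F) u v ↔ G.JoinedBy F u v ∨ (G.JoinedBy F u a ∧ G.JoinedBy F b v) ∨
      (G.JoinedBy F u b ∧ G.JoinedBy F a v) := by
  constructor
  · intro h
    induction h with
    | refl => exact Or.inl (refl _)
    | tail _ h ih =>
      obtain ⟨e, he, h⟩ := h
      rcases he with rfl | he
      · rcases hf.eq_and_eq_or_eq_and_eq h with ⟨rfl, rfl⟩ | ⟨rfl, rfl⟩
        · rcases ih with ih | ih | ih
          · exact Or.inr (Or.inl ⟨ih, refl _⟩)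
          · exact Or.inr (Or.inl ⟨ih.1, refl _⟩)
          · exact Or.inl ih.1
        · rcases ih with ih | ih | ih
          · exact Or.inr (Or.inr ⟨ih, refl _⟩)
          · exact Or.inl ih.1
          · exact Or.inr (Or.inr ⟨ih.1, refl _⟩)
      · have h' : G.JoinedBy F _ _ := of_isLink he h
        rcases ih with ih | ih | ih
        · exact Or.inl (ih.trans h')
        · exact Or.inr (Or.inl ⟨ih.1, ih.2.trans h'⟩)
        · exact Or.inr (Or.inr ⟨ih.1, ih.2.trans h'⟩)
  · have hm : F ⊆ insert f F := subset_insert f F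
    have hl : G.JoinedBy (insert f F) a b := of_isLink (mem_insert f F) hf
    rintro (h | h | h)
    · exact h.mono hm
    · exact ((h.1.mono hm).trans hl).trans (h.2.mono hm)
    · exact ((h.1.mono hm).trans hl.symm).trans (h.2.mono hm)

lemma iff_diff (hf : G.IsLink f a b) (hfF : f ∈ F) :
    G.JoinedBy F u v ↔ G.JoinedBy (F \ {f}) u v ∨
      (G.JoinedBy (F \ {f}) u a ∧ G.JoinedBy (F \ {f}) b v) ∨
      (G.JoinedBy (F \ {f}) u b ∧ G.JoinedBy (F \ {f}) a v) := by
  conv_lhs => rw [← insert_sdiff_self_of_mem hfF]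
  exact insert_iff hf

end JoinedBy

lemma isSpanningTree_iff : G.IsSpanningTree F ↔ F ⊆ G.edgeSet ∧ G.vertexSet.Nonempty ∧
    (∀ u ∈ G.vertexSet, ∀ v ∈ G.vertexSet, G.JoinedBy F u v) ∧
    ∀ e ∈ F, ∀ u v, G.IsLink e u v → ¬ G.JoinedBy (F \ {e}) u v := by
  constructor
  · rintro ⟨h, h1, h2, h3⟩
    refine ⟨h, h1, h2, fun e he u v hl => ?_⟩
    rw [← reaches_deleteEdges_restrict]
    exact h3 e u v ⟨he, hl⟩
  · rintro ⟨h, h1, h2, h3⟩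
    refine ⟨h, h1, h2, fun e u v hl => ?_⟩
    rw [reaches_deleteEdges_restrict]
    exact h3 e hl.1 u v hl.2

namespace IsSpanningTree

lemma subset_edgeSet (h : G.IsSpanningTree F) : F ⊆ G.edgeSet := h.1

lemma joinedBy (h : G.IsSpanningTree F) (hu : u ∈ G.vertexSet) (hv : v ∈ G.vertexSet) :
    G.JoinedBy F u v := h.2.connected u hu v hv

lemma not_joinedBy (h : G.IsSpanningTree F) (he : e ∈ F) (hl : G.IsLink e u v) :
    ¬ G.JoinedBy (F \ {e}) u v := (isSpanningTree_iff.1 h).2.2.2 e he u v hl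

/-- Exchange of edges in a spanning tree: the edge `g = ab` is replaced by an edge `f = cd` which
joins the two components left by `g`. -/
lemma exchange (h : G.IsSpanningTree F) (hg : g ∈ F) (hgl : G.IsLink g a b) (hf : G.IsLink f c d)
    (hc : G.JoinedBy (F \ {g}) c a) (hd : G.JoinedBy (F \ {g}) d b) :
    G.IsSpanningTree (insert f (F \ {g})) := by
  have hab := h.not_joinedBy hg hgl
  have hcd : ¬ G.JoinedBy (F \ {g}) c d := fun h' => hab ((hc.symm.trans h').trans hd)
  have hfF : f ∉ F \ {g} := fun h' => hcd (.of_isLink h' hf)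
  refine isSpanningTree_iff.2 ⟨?_, (isSpanningTree_iff.1 h).2.1, ?_, ?_⟩
  · exact insert_subset hf.edge_mem (sdiff_subset.trans h.subset_edgeSet)
  · have hm : F \ {g} ⊆ insert f (F \ {g}) := subset_insert _ _
    intro u hu v hv
    refine (h.joinedBy hu hv).of_links fun e he x y hxy => ?_
    by_cases heg : e = g
    · subst heg
      have hl : G.JoinedBy (insert f (F \ {e})) a b :=
        ((hc.symm.mono hm).trans (.of_isLink (mem_insert _ _) hf)).trans (hd.mono hm)
      rcases hgl.eq_and_eq_or_eq_and_eq hxy with ⟨rfl, rfl⟩ | ⟨rfl, rfl⟩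
      exacts [hl, hl.symm]
    · exact .of_isLink (hm ⟨he, heg⟩) hxy
  · intro e he u v hl
    by_cases hef : e = f
    · subst hef
      rw [insert_sdiff_self_of_notMem hfF]
      rcases hf.eq_and_eq_or_eq_and_eq hl with ⟨rfl, rfl⟩ | ⟨rfl, rfl⟩
      exacts [hcd, fun h => hcd h.symm]
    · have heH : e ∈ F \ {g} := he.resolve_left hef
      have hs : insert f (F \ {g}) \ {e} = insert f ((F \ {g}) \ {e}) := by
        rw [insert_sdiff_of_notMem _ (fun h => hef h.symm)]
      have hm : (F \ {g}) \ {e} ⊆ F \ {g} := sdiff_subset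
      have hl' : G.JoinedBy (F \ {g}) u v := .of_isLink heH hl
      -- A path through `f` between the ends of `e`, closed up by `e` itself, would join `c` and `d`
      -- without `f`.
      rw [hs, JoinedBy.insert_iff hf]
      rintro (h1 | h1 | h1)
      · refine h.not_joinedBy heH.1 hl (h1.mono ?_)
        exact fun x hx => ⟨hx.1.1, hx.2⟩
      · exact hcd (((h1.1.mono hm).symm.trans hl').trans (h1.2.mono hm).symm)
      · exact hcd (((h1.2.mono hm).trans hl'.symm).trans (h1.1.mono hm))

/-- Every vertex `v` other than `r` has a parent edge, the first edge on its way to `r`. -/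
lemma exists_parent (h : G.IsSpanningTree F) (hv : v ∈ G.vertexSet) (hr : r ∈ G.vertexSet)
    (hvr : v ≠ r) : ∃ e ∈ F, ∃ w, G.IsLink e v w ∧ ¬ G.JoinedBy (F \ {e}) v r := by
  -- `H` isolates `v`. Reading a path to `r` backwards from `r`, either it never meets `v` or it has
  -- a last departure from `v`; the edge of that departure is the parent edge.
  set H : Set β := F \ {e | G.Inc e v} with hH
  have key : ∀ x, G.JoinedBy F x r →
      G.JoinedBy H x r ∨ ∃ e ∈ F, ∃ w, G.IsLink e v w ∧ G.JoinedBy H w r := by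
    intro x hx
    induction hx using Relation.ReflTransGen.head_induction_on with
    | refl => exact Or.inl (.refl _)
    | head hl _ ih =>
      rename_i x y
      obtain ⟨e, he, hl⟩ := hl
      rcases ih with ih | ih
      · by_cases hi : G.Inc e v
        · obtain ⟨z, hz⟩ := hi
          rcases hz.eq_and_eq_or_eq_and_eq hl with ⟨rfl, rfl⟩ | ⟨rfl, rfl⟩
          · exact Or.inr ⟨e, he, _, hl, ih⟩
          · exact Or.inr ⟨e, he, _, hz, by
              exfalso
              rcases Relation.ReflTransGen.cases_head ih with h0 | ⟨y, ⟨e', he', hl'⟩, -⟩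
              · exact hvr h0
              · exact he'.2 ⟨_, hl'⟩⟩
        · exact Or.inl ((JoinedBy.of_isLink (F := H) ⟨he, hi⟩ hl).trans ih)
      · exact Or.inr ih
  rcases key v (h.joinedBy hv hr) with h0 | ⟨e, he, w, hl, hw⟩
  · exfalso
    rcases Relation.ReflTransGen.cases_head h0 with h0 | ⟨y, ⟨e', he', hl'⟩, -⟩
    · exact hvr h0
    · exact he'.2 ⟨_, hl'⟩
  · refine ⟨e, he, w, hl, fun h1 => h.not_joinedBy he hl (h1.trans (hw.symm.mono ?_))⟩
    rintro x ⟨hx, hx'⟩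
    refine ⟨hx, ?_⟩
    rintro rfl
    exact hx' ⟨w, hl⟩

/-- If `e ≠ f`, the far end `w` of `e` reaches `r` without `e`, and also without `f`, since
otherwise `v` would reach `r` without `e`. Going through `e` then connects `v` to `r` without `f`.
-/
lemma parent_unique (h : G.IsSpanningTree F) (hv : v ∈ G.vertexSet) (hr : r ∈ G.vertexSet)
    (he : e ∈ F) (hl : G.IsLink e v w) (hn : ¬ G.JoinedBy (F \ {e}) v r)
    (he' : f ∈ F) (hl' : G.IsLink f v a) (hn' : ¬ G.JoinedBy (F \ {f}) v r) : e = f := by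
  by_contra hef
  have hw : G.JoinedBy (F \ {e}) w r := by
    rcases (JoinedBy.iff_diff hl he).1 (h.joinedBy hv hr) with h1 | h1 | h1
    exacts [absurd h1 hn, h1.2, absurd h1.2 hn]
  have hfe : f ∈ F \ {e} := ⟨he', fun h => hef h.symm⟩
  have hm : (F \ {e}) \ {f} ⊆ F \ {f} := fun x hx => ⟨hx.1.1, hx.2⟩
  have h2 : G.JoinedBy ((F \ {e}) \ {f}) w r := by
    rcases (JoinedBy.iff_diff hl' hfe).1 hw with h1 | h1 | h1
    · exact h1
    · exact absurd ((JoinedBy.of_isLink hfe hl').trans (h1.2.mono sdiff_subset)) hn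
    · exact absurd (h1.2.mono sdiff_subset) hn
  exact hn' ((JoinedBy.of_isLink (F := F \ {f}) ⟨he, hef⟩ hl).trans (h2.mono hm))

end IsSpanningTree

/-- In a finite connected multigraph every edge which is not a loop lies in a spanning tree. -/
lemma exists_isSpanningTree_mem (hfin : G.edgeSet.Finite)
    (hconn : ∀ u ∈ G.vertexSet, ∀ v ∈ G.vertexSet, G.JoinedBy G.edgeSet u v)
    (ho : G.IsLink o t r) (htr : t ≠ r) : ∃ F, G.IsSpanningTree F ∧ o ∈ F := by
  -- A maximal acyclic edge set containing `o` spans: an edge whose ends it left unjoined could be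
  -- added without creating a cycle.
  let S : Set (Set β) := {F | F ⊆ G.edgeSet ∧ o ∈ F ∧
    ∀ e ∈ F, ∀ u v, G.IsLink e u v → ¬ G.JoinedBy (F \ {e}) u v}
  have hS : S.Finite := hfin.finite_subsets.subset fun F hF => hF.1
  have hne : S.Nonempty := by
    refine ⟨{o}, by simpa using ho.edge_mem, rfl, ?_⟩
    rintro e rfl u v hl hj
    rw [sdiff_self] at hj
    rcases Relation.ReflTransGen.cases_head hj with rfl | ⟨y, ⟨e', he', -⟩, -⟩
    · rcases ho.eq_and_eq_or_eq_and_eq hl with h | h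
      · exact htr (h.1.trans h.2.symm)
      · exact htr (h.1.trans h.2.symm)
    · exact he'
  obtain ⟨F, hF⟩ := hS.exists_maximal hne
  obtain ⟨⟨hFE, hoF, hac⟩, hmax⟩ := hF
  refine ⟨F, isSpanningTree_iff.2 ⟨hFE, ⟨t, ho.left_mem⟩, fun u hu v hv => ?_, hac⟩, hoF⟩
  refine (hconn u hu v hv).of_links fun f _ c d hf => ?_
  by_contra hcd
  have hfF : f ∉ F := fun h => hcd (.of_isLink h hf)
  refine hfF (hmax (y := insert f F) ⟨?_, mem_insert_of_mem _ hoF, ?_⟩ (subset_insert _ _)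
    (mem_insert _ _))
  · exact insert_subset hf.edge_mem hFE
  · intro e he u v hl
    by_cases hef : e = f
    · subst hef
      rw [insert_sdiff_self_of_notMem hfF]
      rcases hf.eq_and_eq_or_eq_and_eq hl with ⟨rfl, rfl⟩ | ⟨rfl, rfl⟩
      exacts [hcd, fun h => hcd h.symm]
    · have heF : e ∈ F := he.resolve_left hef
      have hl' : G.JoinedBy F u v := .of_isLink heF hl
      have hm : F \ {e} ⊆ F := sdiff_subset
      rw [insert_sdiff_of_notMem _ (fun h => hef h.symm), JoinedBy.insert_iff hf]
      rintro (h1 | h1 | h1)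
      · exact hac e heF u v hl h1
      · exact hcd (((h1.1.mono hm).symm.trans hl').trans (h1.2.mono hm).symm)
      · exact hcd (((h1.2.mono hm).trans hl'.symm).trans (h1.1.mono hm))

end Graph

/-! ### Random spanning trees of the grid -/

/-- The four nearest neighbours of a lattice site. -/
def latticeNeighbors (p : ℤ × ℤ) : Finset (ℤ × ℤ) :=
  {(p.1 + 1, p.2), (p.1 - 1, p.2), (p.1, p.2 + 1), (p.1, p.2 - 1)}

lemma mem_latticeNeighbors {p q : ℤ × ℤ} : q ∈ latticeNeighbors p ↔ LatticeAdj p q := by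
  obtain ⟨a, b⟩ := p
  obtain ⟨c, d⟩ := q
  simp only [latticeNeighbors, LatticeAdj, Finset.mem_insert, Finset.mem_singleton, Prod.mk.injEq]
  constructor
  · rintro (⟨rfl, rfl⟩ | ⟨rfl, rfl⟩ | ⟨rfl, rfl⟩ | ⟨rfl, rfl⟩) <;> simp
  · intro h
    rcases abs_cases (a - c) with h1 | h1 <;> rcases abs_cases (b - d) with h2 | h2 <;> omega

lemma sum_latticeNeighbors {M : Type*} [AddCommMonoid M] (p : ℤ × ℤ) (f : ℤ × ℤ → M) :
    ∑ q ∈ latticeNeighbors p, f q =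
      f (p.1 + 1, p.2) + (f (p.1 - 1, p.2) + (f (p.1, p.2 + 1) + f (p.1, p.2 - 1))) := by
  unfold latticeNeighbors
  rw [Finset.sum_insert, Finset.sum_insert, Finset.sum_insert, Finset.sum_singleton]
  all_goals simp [Prod.ext_iff]
  all_goals omega

section Grid

variable {n m : ℕ} {p q : ℤ × ℤ} {F : Set (Option (Sym2 (ℤ × ℤ)))}

lemma mem_gridVertices : p ∈ gridVertices n m ↔
    (1 ≤ p.1 ∧ p.1 ≤ n) ∧ (1 ≤ p.2 ∧ p.2 ≤ m) := by
  simp [gridVertices]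

lemma gridEndpoint_of_mem (hp : p ∈ gridVertices n m) : gridEndpoint n m p = .site p := by
  simp [gridEndpoint, hp]

lemma gridEndpoint_eq_site {r : ℤ × ℤ} :
    gridEndpoint n m q = .site r ↔ q = r ∧ q ∈ gridVertices n m := by
  unfold gridEndpoint
  split_ifs with h1 h2
  · simp [h1]
  · simp [h1]
  · simp [h1]

lemma gridEndpoint_of_notMem (hq : q ∉ gridVertices n m) (h : q ≠ (0, 1)) :
    gridEndpoint n m q = .root := by
  simp [gridEndpoint, hq, h]

lemma gridEndpoint_eq_terminal : gridEndpoint n m q = .terminal ↔ q = (0, 1) := by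
  unfold gridEndpoint
  split_ifs with h1 h2
  · simp only [false_iff]
    rintro rfl
    simp [mem_gridVertices] at h1
  · simp [h2]
  · simp [h2]

lemma gridEndpoint_mem (q : ℤ × ℤ) : gridEndpoint n m q ∈ (gridTR n m).vertexSet := by
  unfold gridEndpoint
  split_ifs with h1 h2
  · exact Or.inl ⟨q, h1, rfl⟩
  · exact Or.inr (Or.inl rfl)
  · exact Or.inr (Or.inr rfl)

lemma site_mem (hp : p ∈ gridVertices n m) : GridVertex.site p ∈ (gridTR n m).vertexSet :=
  Or.inl ⟨p, hp, rfl⟩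

lemma root_mem : GridVertex.root ∈ (gridTR n m).vertexSet := Or.inr (Or.inr rfl)

lemma gridTR_isLink_none : (gridTR n m).IsLink none .terminal .root :=
  Or.inl ⟨rfl, Or.inl ⟨rfl, rfl⟩⟩

lemma gridTR_isLink (hp : p ∈ gridVertices n m) (hq : q ∈ latticeNeighbors p) :
    (gridTR n m).IsLink (some s(p, q)) (.site p) (gridEndpoint n m q) :=
  Or.inr ⟨p, q, rfl, mem_latticeNeighbors.1 hq, Or.inl hp, (gridEndpoint_of_mem hp).symm, rfl⟩

lemma gridTR_isLink_site {e : Option (Sym2 (ℤ × ℤ))} {w : GridVertex}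
    (h : (gridTR n m).IsLink e (.site p) w) :
    p ∈ gridVertices n m ∧ ∃ q ∈ latticeNeighbors p, e = some s(p, q) ∧ w = gridEndpoint n m q := by
  rcases h with ⟨-, h⟩ | ⟨p', q, he, hpq, -, hv, hw⟩
  · simp at h
  · obtain ⟨rfl, hp⟩ := gridEndpoint_eq_site.1 hv.symm
    exact ⟨hp, q, mem_latticeNeighbors.2 hpq, he, hw⟩

lemma gridTR_edgeSet_finite : (gridTR n m).edgeSet.Finite := by
  classical
  refine (((gridVertices n m).biUnion fun p =>
    (latticeNeighbors p).image fun q => some s(p, q)) ∪ {none}).finite_toSet.subset ?_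
  intro e he
  obtain ⟨x, y, h⟩ := (gridTR n m).exists_isLink_of_mem_edgeSet he
  simp only [Finset.coe_union, Finset.coe_biUnion, Finset.coe_image, Finset.coe_singleton]
  rcases h with ⟨rfl, -⟩ | ⟨p, q, rfl, hpq, hp | hq, -, -⟩
  · simp
  · refine Or.inl (mem_biUnion hp ⟨q, mem_latticeNeighbors.2 hpq, rfl⟩)
  · refine Or.inl (mem_biUnion hq ⟨p, mem_latticeNeighbors.2 ?_, by rw [Sym2.eq_swap]⟩)
    unfold LatticeAdj at *
    rw [abs_sub_comm q.1, abs_sub_comm q.2, hpq]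

lemma gridTR_joinedBy_edgeSet {v : GridVertex} (hv : v ∈ (gridTR n m).vertexSet) :
    (gridTR n m).JoinedBy (gridTR n m).edgeSet v .root := by
  -- Walk to the right; `k` is the distance to column n+1. Since `1 ≤ p.1`, the walk avoids (0,1),
  -- so its exit is the root and not the terminal.
  have key : ∀ k : ℕ, ∀ p : ℤ × ℤ, 1 ≤ p.1 → p.1 + k = n + 1 →
      (gridTR n m).JoinedBy (gridTR n m).edgeSet (gridEndpoint n m p) .root := by
    intro k
    induction k with
    | zero =>
      intro p h1 h2
      rw [gridEndpoint_of_notMem]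
      · exact .refl _
      · rw [mem_gridVertices]; push_cast at h2; omega
      · rintro rfl
        simp at h1
    | succ k ih =>
      intro p h1 h2
      by_cases hp : p ∈ gridVertices n m
      · have hq : (p.1 + 1, p.2) ∈ latticeNeighbors p := by simp [latticeNeighbors]
        have hl := gridTR_isLink hp hq
        rw [gridEndpoint_of_mem hp]
        exact (Graph.JoinedBy.of_isLink hl.edge_mem hl).trans
          (ih (p.1 + 1, p.2) (by simp only; omega) (by push_cast at h2 ⊢; omega))
      · rw [gridEndpoint_of_notMem hp]
        · exact .refl _
        · rintro rfl
          simp at h1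
  rcases hv with ⟨p, hp, rfl⟩ | rfl | rfl
  · rw [← gridEndpoint_of_mem hp]
    have hp' := mem_gridVertices.1 hp
    exact key (n + 1 - p.1).toNat p hp'.1.1 (by omega)
  · exact .of_isLink gridTR_isLink_none.edge_mem gridTR_isLink_none
  · exact .refl _

lemma tiSpanningTrees_finite : (tiSpanningTrees n m).Finite :=
  gridTR_edgeSet_finite.finite_subsets.subset fun _ hF => hF.1.1

lemma tiSpanningTrees_nonempty : (tiSpanningTrees n m).Nonempty :=
  Graph.exists_isSpanningTree_mem gridTR_edgeSet_finite
    (fun _ hu _ hv => (gridTR_joinedBy_edgeSet hu).trans (gridTR_joinedBy_edgeSet hv).symm)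
    gridTR_isLink_none (by simp)

/-- The vertex `v` belongs to the TI-tree of the spanning tree `F`. -/
def MemTITree (n m : ℕ) (F : Set (Option (Sym2 (ℤ × ℤ)))) (v : GridVertex) : Prop :=
  (gridTR n m).JoinedBy (F \ {none}) .terminal v

/-- The edge leading from the site `p` to its neighbour `q` is the parent edge of `p`. -/
def IsParent (n m : ℕ) (F : Set (Option (Sym2 (ℤ × ℤ)))) (p q : ℤ × ℤ) : Prop :=
  q ∈ latticeNeighbors p ∧ some s(p, q) ∈ F ∧
    ¬ (gridTR n m).JoinedBy (F \ {some s(p, q)}) (.site p) .root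

lemma exists_isParent (hF : (gridTR n m).IsSpanningTree F) (hp : p ∈ gridVertices n m) :
    ∃ q, IsParent n m F p q := by
  obtain ⟨e, he, w, hl, hn⟩ := hF.exists_parent (site_mem hp) root_mem (by simp)
  obtain ⟨-, q, hq, rfl, -⟩ := gridTR_isLink_site hl
  exact ⟨q, hq, he, hn⟩

lemma IsParent.unique {q' : ℤ × ℤ} (hF : (gridTR n m).IsSpanningTree F)
    (hp : p ∈ gridVertices n m) (h : IsParent n m F p q) (h' : IsParent n m F p q') : q = q' := by
  have := hF.parent_unique (site_mem hp) root_mem h.2.1 (gridTR_isLink hp h.1) h.2.2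
    h'.2.1 (gridTR_isLink hp h'.1) h'.2.2
  rcases Sym2.eq_iff.1 (Option.some.inj this) with h1 | h1
  exacts [h1.2, h1.2.trans h1.1]

/-- A component cut off from the root in `F \ {g}` does not meet the terminal. -/
lemma not_joinedBy_terminal {H : Set (Option (Sym2 (ℤ × ℤ)))} {v : GridVertex} (ho : none ∈ H)
    (h : ¬ (gridTR n m).JoinedBy H v .root) : ¬ (gridTR n m).JoinedBy H v .terminal :=
  fun h' => h (h'.trans (.of_isLink ho gridTR_isLink_none))

/-- Replacing the parent edge of `p` by the edge from `p` to a neighbour `q` which is not a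
descendant of `p`. -/
lemma reroot {q' : ℤ × ℤ} (hF : F ∈ tiSpanningTrees n m) (hp : p ∈ gridVertices n m)
    (hq' : IsParent n m F p q') (hq : q ∈ latticeNeighbors p)
    (hn : ¬ (gridTR n m).JoinedBy (F \ {some s(p, q')}) (gridEndpoint n m q) (.site p)) :
    insert (some s(p, q)) (F \ {some s(p, q')}) ∈ tiSpanningTrees n m ∧
    IsParent n m (insert (some s(p, q)) (F \ {some s(p, q')})) p q ∧
    insert (some s(p, q)) (F \ {some s(p, q')}) \ {some s(p, q)} = F \ {some s(p, q')} ∧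
    ¬ (gridTR n m).JoinedBy (F \ {some s(p, q')}) (gridEndpoint n m q') (.site p) ∧
    (MemTITree n m F (gridEndpoint n m q) ↔
      MemTITree n m (insert (some s(p, q)) (F \ {some s(p, q')})) (.site p)) ∧
    (MemTITree n m F (.site p) ↔
      MemTITree n m (insert (some s(p, q)) (F \ {some s(p, q')})) (gridEndpoint n m q')) := by
  set g : Option (Sym2 (ℤ × ℤ)) := some s(p, q') with hg
  set f : Option (Sym2 (ℤ × ℤ)) := some s(p, q) with hf
  set H := F \ {g} with hH
  have hgl := gridTR_isLink hp hq'.1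
  have hfl := gridTR_isLink hp hq
  have hfH : f ∉ H := fun h => hn (Graph.JoinedBy.of_isLink h hfl).symm
  have hoH : none ∈ H := ⟨hF.2, by simp [hg]⟩
  have hFH : F = insert g H := by rw [hH, insert_sdiff_self_of_mem hq'.2.1]
  have hpT := not_joinedBy_terminal hoH hq'.2.2
  have hq'p : ¬ (gridTR n m).JoinedBy H (gridEndpoint n m q') (.site p) :=
    fun h => hF.1.not_joinedBy hq'.2.1 hgl h.symm
  have hqq' : (gridTR n m).JoinedBy H (gridEndpoint n m q) (gridEndpoint n m q') := by
    rcases (Graph.JoinedBy.iff_diff hgl hq'.2.1).1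
      (hF.1.joinedBy (gridEndpoint_mem q) (gridEndpoint_mem q')) with h | h | h
    exacts [h, absurd h.1 hn, h.1]
  have hdiff : insert f H \ {f} = H := insert_sdiff_self_of_notMem hfH
  have hm : H \ {none} ⊆ H := sdiff_subset
  have e1 : insert f H \ {none} = insert f (H \ {none}) :=
    insert_sdiff_of_notMem _ (by simp [hf])
  have e2 : F \ {none} = insert g (H \ {none}) := by
    rw [hFH, insert_sdiff_of_notMem _ (by simp [hg])]
  refine ⟨⟨hF.1.exchange hq'.2.1 hgl hfl (.refl _) hqq', mem_insert_of_mem _ hoH⟩,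
    ⟨hq, mem_insert _ _, by rw [hdiff]; exact hq'.2.2⟩, hdiff, hq'p, ?_, ?_⟩
  -- Both sides say that T reaches `q` in `H \ {none}`: the component of `p` in `H` contains neither
  -- T nor `q`. The second equivalence is the same with `q'` in place of `q`.
  · rw [MemTITree, MemTITree, e1, e2, Graph.JoinedBy.insert_iff hgl, Graph.JoinedBy.insert_iff hfl]
    constructor
    · rintro (h | h | h)
      · exact Or.inr (Or.inr ⟨h, .refl _⟩)
      · exact absurd (h.1.mono hm).symm hpT
      · exact absurd (h.2.mono hm).symm hn
    · rintro (h | h | h)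
      · exact absurd (h.mono hm).symm hpT
      · exact absurd (h.1.mono hm).symm hpT
      · exact Or.inl h.1
  · rw [MemTITree, MemTITree, e1, e2, Graph.JoinedBy.insert_iff hgl, Graph.JoinedBy.insert_iff hfl]
    constructor
    · rintro (h | h | h)
      · exact absurd (h.mono hm).symm hpT
      · exact absurd (h.1.mono hm).symm hpT
      · exact Or.inl h.1
    · rintro (h | h | h)
      · exact Or.inr (Or.inr ⟨h, .refl _⟩)
      · exact absurd (h.1.mono hm).symm hpT
      · exact absurd (h.2.mono hm).symm hq'p

/-- A descendant of `p` lies in the TI-tree if and only if `p` does. -/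
lemma memTITree_descendant {q' : ℤ × ℤ} {v : GridVertex} (hF : F ∈ tiSpanningTrees n m)
    (hq' : IsParent n m F p q')
    (hv : (gridTR n m).JoinedBy (F \ {some s(p, q')}) v (.site p)) :
    MemTITree n m F v ↔ MemTITree n m F (.site p) := by
  set H := F \ {some s(p, q')} with hH
  have hoH : none ∈ H := ⟨hF.2, by simp⟩
  have hm : H \ {none} ⊆ H := sdiff_subset
  have hv' : (gridTR n m).JoinedBy (H \ {none}) v (.site p) := by
    -- A path from `v` to `p` through TR would join `p` to the root or the terminal, from which `H`
    -- separates it.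
    rcases (Graph.JoinedBy.iff_diff gridTR_isLink_none hoH).1 hv with h | h | h
    · exact h
    · exact absurd (h.2.mono hm).symm hq'.2.2
    · exact absurd (h.2.mono hm).symm (not_joinedBy_terminal hoH hq'.2.2)
  have hv'' : (gridTR n m).JoinedBy (F \ {none}) v (.site p) :=
    hv'.mono fun x hx => ⟨hx.1.1, hx.2⟩
  exact ⟨fun h => h.trans hv'', fun h => h.trans hv''.symm⟩

open Classical in
/-- The number of spanning trees whose TI-tree contains `v`. -/
noncomputable def tiCount (n m : ℕ) (v : GridVertex) : ℝ :=
  ∑ F ∈ (tiSpanningTrees_finite (n := n) (m := m)).toFinset, if MemTITree n m F v then 1 else 0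

lemma tiCount_terminal : tiCount n m .terminal = (tiSpanningTrees n m).ncard := by
  have h : ∀ F, MemTITree n m F .terminal := fun F => .refl _
  simp [tiCount, h, ncard_eq_toFinset_card _ (tiSpanningTrees_finite (n := n) (m := m))]

lemma tiCount_root : tiCount n m .root = 0 := by
  refine Finset.sum_eq_zero fun F hF => if_neg fun h => ?_
  have hF := (Finite.mem_toFinset _).1 hF
  exact hF.1.not_joinedBy hF.2 gridTR_isLink_none h

/-- The counting function of the TI-tree is harmonic on the grid. -/
lemma tiCount_harmonic (hp : p ∈ gridVertices n m) :
    ∑ q ∈ latticeNeighbors p, (tiCount n m (.site p) - tiCount n m (gridEndpoint n m q)) = 0 := by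
  classical
  choose! par hpar using fun (F : Set (Option (Sym2 (ℤ × ℤ)))) (hF : F ∈ tiSpanningTrees n m) =>
    exists_isParent hF.1 hp
  -- The involution: fixed when the neighbour is a descendant of `p` (it then shares the status of
  -- `p`), otherwise the new and the old parent of `p` are swapped.
  let φ : (ℤ × ℤ) × Set (Option (Sym2 (ℤ × ℤ))) → (ℤ × ℤ) × Set (Option (Sym2 (ℤ × ℤ))) := fun x =>
    if (gridTR n m).JoinedBy (x.2 \ {some s(p, par x.2)}) (gridEndpoint n m x.1) (.site p) then x
    else (par x.2, insert (some s(p, x.1)) (x.2 \ {some s(p, par x.2)}))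
  let S := latticeNeighbors p ×ˢ (tiSpanningTrees_finite (n := n) (m := m)).toFinset
  have hS : ∀ x, x ∈ S ↔ x.1 ∈ latticeNeighbors p ∧ x.2 ∈ tiSpanningTrees n m := fun x => by
    simp [S, Finset.mem_product]
  have hφ : ∀ x ∈ S, φ x ∈ S ∧ φ (φ x) = x ∧
      (MemTITree n m x.2 (.site p) ↔ MemTITree n m (φ x).2 (gridEndpoint n m (φ x).1)) := by
    rintro ⟨q, F⟩ hx
    obtain ⟨hq, hF⟩ := (hS _).1 hx
    simp only at hq hF
    by_cases hc : (gridTR n m).JoinedBy (F \ {some s(p, par F)}) (gridEndpoint n m q) (.site p)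
    · have h1 : φ (q, F) = (q, F) := if_pos hc
      rw [h1, h1]
      exact ⟨hx, rfl, (memTITree_descendant hF (hpar F hF) hc).symm⟩
    · have h1 : φ (q, F) = (par F, insert (some s(p, q)) (F \ {some s(p, par F)})) := if_neg hc
      obtain ⟨h2, h3, h4, h5, -, h7⟩ := reroot hF hp (hpar F hF) hq hc
      have h8 := (hpar _ h2).unique h2.1 hp h3
      have h9 : φ (φ (q, F)) = (q, F) := by
        rw [h1]
        simp only [φ]
        rw [h8, h4, if_neg h5, insert_sdiff_self_of_mem (hpar F hF).2.1]
      refine ⟨(hS _).2 ?_, h9, ?_⟩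
      · rw [h1]; exact ⟨(hpar F hF).1, h2⟩
      · rw [h1]; exact h7
  rw [Finset.sum_sub_distrib, sub_eq_zero]
  simp only [tiCount]
  rw [← Finset.sum_product', ← Finset.sum_product']
  refine Finset.sum_nbij' φ φ (fun x hx => (hφ x hx).1) (fun x hx => (hφ x hx).1)
    (fun x hx => (hφ x hx).2.1) (fun x hx => (hφ x hx).2.1) (fun x hx => ?_)
  simp only [(hφ x hx).2.2]

/-- The expected length of the TI-tree, as a sum over the sites. -/
lemma expectedTILength_eq_sum_tiCount : expectedTILength n m =
    (∑ p ∈ gridVertices n m, tiCount n m (.site p)) / ((tiSpanningTrees n m).ncard : ℝ) := by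
  classical
  unfold expectedTILength tiCount
  rw [finsum_mem_eq_finite_toFinset_sum _ tiSpanningTrees_finite, Finset.sum_comm]
  congr 1
  refine Finset.sum_congr rfl fun F _ => ?_
  rw [Finset.sum_boole]
  congr 1
  unfold tiLength
  rw [← ncard_coe_finset]
  congr 1
  ext p
  simp only [Graph.reaches_deleteEdges_restrict, Finset.coe_filter]
  rfl

/-! ### The Laplacian on the grid -/

lemma edgeMultiplicity_site (hp : p ∈ gridVertices n m) (w : GridVertex) [DecidableEq GridVertex] :
    edgeMultiplicity (gridTR n m) (.site p) w =
      ((latticeNeighbors p).filter fun q => gridEndpoint n m q = w).card := by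
  classical
  rw [edgeMultiplicity, ← ncard_coe_finset]
  symm
  refine ncard_congr (fun q _ => some s(p, q)) ?_ ?_ ?_
  · intro q hq
    simp only [Finset.coe_filter, mem_ofPred_eq] at hq
    simpa [hq.2] using gridTR_isLink hp hq.1
  · intro q q' _ _ h
    rcases Sym2.eq_iff.1 (Option.some.inj h) with h1 | h1
    exacts [h1.2, h1.2.trans h1.1]
  · intro e he
    obtain ⟨-, q, hq, rfl, rfl⟩ := gridTR_isLink_site he
    exact ⟨q, by simpa using hq, rfl⟩

lemma gridTR_vertexSet_finite : (gridTR n m).vertexSet.Finite := by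
  refine (((gridVertices n m).finite_toSet.image GridVertex.site).union
    (toFinite {GridVertex.terminal, GridVertex.root})).subset ?_
  rintro v (⟨p, hp, rfl⟩ | rfl | rfl)
  · exact Or.inl ⟨p, hp, rfl⟩
  · simp
  · simp

/-- Edge multiplicities are the fibre sizes of `gridEndpoint` on the four lattice neighbours,
several of which may be merged into R. -/
lemma graphLaplacian_site (hp : p ∈ gridVertices n m) (f : GridVertex → ℝ) :
    graphLaplacian (gridTR n m) f (.site p) =
      ∑ q ∈ latticeNeighbors p, (f (.site p) - f (gridEndpoint n m q)) := by
  classical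
  rw [graphLaplacian, finsum_mem_eq_finite_toFinset_sum _ gridTR_vertexSet_finite]
  rw [← Finset.sum_fiberwise_of_maps_to (s := latticeNeighbors p) (g := gridEndpoint n m)
    (t := (gridTR_vertexSet_finite (n := n) (m := m)).toFinset)]
  · refine Finset.sum_congr rfl fun w _ => ?_
    rw [edgeMultiplicity_site hp, Finset.sum_congr rfl
      (g := fun _ => f (.site p) - f w)
      (fun q hq => by rw [(Finset.mem_filter.1 hq).2]), Finset.sum_const, nsmul_eq_mul]
  · intro q _
    exact (Finite.mem_toFinset _).2 (gridEndpoint_mem q)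

/-- `gridK` is the lattice Laplacian with zero boundary values: T and R both count as 0. -/
lemma gridK_mulVec (hp : p ∈ gridVertices n m) (u : ℤ × ℤ → ℝ) :
    (gridK n m).mulVec (fun q => u q) ⟨p, hp⟩ =
      ∑ q ∈ latticeNeighbors p, (u p - if q ∈ gridVertices n m then u q else 0) := by
  classical
  simp only [Matrix.mulVec, dotProduct, gridK, Matrix.of_apply]
  simp_rw [graphLaplacian_site hp, Finset.sum_mul]
  rw [Finset.sum_comm]
  refine Finset.sum_congr rfl fun r _ => ?_
  simp_rw [sub_mul, Finset.sum_sub_distrib]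
  congr 1
  · rw [Finset.sum_eq_single ⟨p, hp⟩]
    · simp
    · rintro ⟨q, hq⟩ - hne
      have : p ≠ q := fun h => hne (Subtype.ext h.symm)
      simp [indicator, this]
    · simp
  · split_ifs with hr
    · rw [Finset.sum_eq_single ⟨r, hr⟩]
      · simp [gridEndpoint_of_mem hr]
      · rintro ⟨q, hq⟩ - hne
        have : r ≠ q := fun h => hne (Subtype.ext h.symm)
        simp [indicator, gridEndpoint_of_mem hr, this]
      · simp
    · refine Finset.sum_eq_zero fun q _ => ?_
      have : gridEndpoint n m r ≠ .site q := fun h => hr (gridEndpoint_eq_site.1 h).2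
      simp [indicator, this]

/-- The law of the TI-tree and the Green function of the grid. -/
lemma gridK_mulVec_tiCount (hp : p ∈ gridVertices n m) :
    (gridK n m).mulVec (fun q => tiCount n m (.site q)) ⟨p, hp⟩ =
      if p = (1, 1) then ((tiSpanningTrees n m).ncard : ℝ) else 0 := by
  have h := tiCount_harmonic hp
  rw [gridK_mulVec hp (fun q => tiCount n m (.site q))]
  -- The count has boundary value 0 at R, so it differs from its extension by zero only at T, that
  -- is at (0,1), whose only neighbour in the grid is (1,1).
  have h1 : ∀ q ∈ latticeNeighbors p,
      ((tiCount n m (.site p) - if q ∈ gridVertices n m then tiCount n m (.site q) else 0) -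
        (tiCount n m (.site p) - tiCount n m (gridEndpoint n m q))) =
      if q = (0, 1) then ((tiSpanningTrees n m).ncard : ℝ) else 0 := by
    intro q _
    split_ifs with h1 h2 h2
    · subst h2
      simp [mem_gridVertices] at h1
    · rw [gridEndpoint_of_mem h1]; ring
    · rw [gridEndpoint_eq_terminal.2 h2, tiCount_terminal]; ring
    · rw [gridEndpoint_of_notMem h1 h2, tiCount_root]; ring
  have h2 := Finset.sum_congr rfl h1
  rw [Finset.sum_sub_distrib, h, sub_zero] at h2
  rw [h2, Finset.sum_ite_eq']
  refine if_congr ?_ rfl rfl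
  have := mem_gridVertices.1 hp
  obtain ⟨a, b⟩ := p
  simp only [latticeNeighbors, Finset.mem_insert, Finset.mem_singleton, Prod.mk.injEq] at *
  omega

/-- Dividing the counts by the number of trees, which is nonzero, identifies the probability that
`p` lies in the TI-tree with the Green function entry at `p` and (1,1). -/
lemma expectedTILength_eq_sum_gridA (hn : 1 ≤ n) (hm : 1 ≤ m) (hK : IsUnit (gridK n m).det) :
    expectedTILength n m = ∑ p ∈ gridVertices n m, gridA n m p (1, 1) := by
  classical
  have hc : ((1, 1) : ℤ × ℤ) ∈ gridVertices n m := by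
    rw [mem_gridVertices]; simp only; omega
  have hN : ((tiSpanningTrees n m).ncard : ℝ) ≠ 0 := by
    have := (ncard_pos tiSpanningTrees_finite).2 (tiSpanningTrees_nonempty (n := n) (m := m))
    exact_mod_cast this.ne'
  have h1 : (gridK n m).mulVec (fun q => tiCount n m (.site q)) =
      Pi.single ⟨(1, 1), hc⟩ ((tiSpanningTrees n m).ncard : ℝ) := by
    ext ⟨p, hp⟩
    rw [gridK_mulVec_tiCount hp]
    simp [Pi.single_apply]
  have h2 : (fun q : gridVertices n m => tiCount n m (.site q)) =
      (gridK n m)⁻¹.mulVec (Pi.single ⟨(1, 1), hc⟩ ((tiSpanningTrees n m).ncard : ℝ)) := by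
    rw [← h1, Matrix.mulVec_mulVec, Matrix.nonsing_inv_mul _ hK, Matrix.one_mulVec]
  rw [expectedTILength_eq_sum_tiCount, Finset.sum_div]
  refine Finset.sum_congr rfl fun p hp => ?_
  have h3 := congrFun h2 ⟨p, hp⟩
  simp only at h3
  rw [h3, gridA, dif_pos ⟨hp, hc⟩, Matrix.mulVec_single]
  simp [hN]

end Grid

/-! ### Diagonalization of the grid Laplacian -/

lemma two_mul_sin_mul_sum_cos (N : ℕ) (α : ℝ) :
    2 * sin (α / 2) * ∑ k ∈ Finset.range N, cos (k * α) = sin ((N - 1 / 2) * α) + sin (α / 2) := by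
  induction N with
  | zero =>
    rw [show ((0 : ℕ) - 1 / 2 : ℝ) * α = -(α / 2) by push_cast; ring, sin_neg]
    simp
  | succ N ih =>
    rw [Finset.sum_range_succ, mul_add, ih]
    push_cast
    rw [show ((N : ℝ) - 1 / 2) * α = N * α - α / 2 by ring,
      show ((N : ℝ) + 1 - 1 / 2) * α = N * α + α / 2 by ring, sin_sub, sin_add]
    ring

lemma two_mul_sin_mul_sum_sin (N : ℕ) (α : ℝ) :
    2 * sin (α / 2) * ∑ k ∈ Finset.range N, sin (k * α) = cos (α / 2) - cos ((N - 1 / 2) * α) := by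
  induction N with
  | zero =>
    rw [show ((0 : ℕ) - 1 / 2 : ℝ) * α = -(α / 2) by push_cast; ring, cos_neg]
    simp
  | succ N ih =>
    rw [Finset.sum_range_succ, mul_add, ih]
    push_cast
    rw [show ((N : ℝ) - 1 / 2) * α = N * α - α / 2 by ring,
      show ((N : ℝ) + 1 - 1 / 2) * α = N * α + α / 2 by ring, cos_sub, cos_add]
    ring

/-- The value depends only on the parity of `j`: 0 if even, 1 if odd. The bound on `j` keeps
sin(πj/(2N)) away from zero, so the telescoped identity can be divided by it. -/
lemma sum_cos_pi_mul_div {N : ℕ} {j : ℤ} (h0 : j ≠ 0) (h : |j| < 2 * N) :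
    ∑ k ∈ Finset.range N, cos (k * (π * j / N)) = (1 - cos (j * π)) / 2 := by
  have hN : (0 : ℝ) < N := by
    have := abs_nonneg j
    have : 0 < N := by omega
    exact_mod_cast this
  have hs : sin (π * j / N / 2) ≠ 0 := by
    rw [Ne, sin_eq_zero_iff]
    rintro ⟨z, hz⟩
    have h1 : (j : ℝ) = z * (2 * N) := by
      field_simp at hz
      linarith
    have h2 : j = z * (2 * N) := by exact_mod_cast h1
    have h3 : z ≠ 0 := by rintro rfl; simp at h2; exact h0 h2
    rw [h2, abs_mul, abs_of_nonneg (by positivity : (0 : ℤ) ≤ 2 * N)] at h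
    have := Int.one_le_abs h3
    nlinarith
  have h1 := two_mul_sin_mul_sum_cos N (π * j / N)
  rw [show ((N : ℝ) - 1 / 2) * (π * j / N) = j * π - π * j / N / 2 by field_simp, sin_sub,
    sin_int_mul_pi] at h1
  refine mul_left_cancel₀ (mul_ne_zero two_ne_zero hs) (h1.trans ?_)
  ring

lemma sum_sin_mul_sin {N : ℕ} {x y : ℤ} (hx : 0 < x ∧ x < N) (hy : 0 < y ∧ y < N) :
    ∑ k ∈ Finset.range N, sin (π * k / N * x) * sin (π * k / N * y) =
      if x = y then (N : ℝ) / 2 else 0 := by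
  have hN : (N : ℝ) ≠ 0 := by
    have : 0 < N := by omega
    positivity
  have h1 : ∀ k : ℕ, sin (π * k / N * x) * sin (π * k / N * y) =
      (cos (k * (π * (x - y : ℤ) / N)) - cos (k * (π * (x + y : ℤ) / N))) / 2 := by
    intro k
    rw [show (k : ℝ) * (π * (x - y : ℤ) / N) = π * k / N * x - π * k / N * y by push_cast; ring,
      show (k : ℝ) * (π * (x + y : ℤ) / N) = π * k / N * x + π * k / N * y by push_cast; ring,
      cos_sub, cos_add]
    ring
  -- x−y and x+y have the same parity, so for x ≠ y the two cosine sums cancel.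
  have hc : cos ((x - y : ℤ) * π) = cos ((x + y : ℤ) * π) := by
    rw [← cos_sub_int_mul_two_pi ((x + y : ℤ) * π) y]
    congr 1
    push_cast
    ring
  simp_rw [h1]
  rw [← Finset.sum_div, Finset.sum_sub_distrib,
    sum_cos_pi_mul_div (j := x + y) (by omega) (abs_lt.2 ⟨by omega, by omega⟩), ← hc]
  split_ifs with hxy
  · subst hxy
    simp
  · rw [sum_cos_pi_mul_div (j := x - y) (by omega) (abs_lt.2 ⟨by omega, by omega⟩)]
    simp

lemma cos_pi_mul_div_lt_one {N k : ℕ} (hk : k ≠ 0) (hkN : k < N) : cos (π * k / N) < 1 := by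
  rw [← cos_zero]
  have hN : (0 : ℝ) < N := by exact_mod_cast (by omega : 0 < N)
  have hk' : (0 : ℝ) < k := by exact_mod_cast (by omega : 0 < k)
  refine cos_lt_cos_of_nonneg_of_le_pi le_rfl ?_ (by positivity)
  rw [div_le_iff₀ hN]
  gcongr

lemma two_sub_cos_sub_cos_ne_zero {N k l : ℕ} (hk : k < N) (hl : l < N) (h : k ≠ 0 ∨ l ≠ 0) :
    2 - cos (π * k / N) - cos (π * l / N) ≠ 0 := by
  rcases h with h | h
  · have h1 := cos_pi_mul_div_lt_one h hk
    have h2 := cos_le_one (π * l / N)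
    linarith
  · have h1 := cos_pi_mul_div_lt_one h hl
    have h2 := cos_le_one (π * k / N)
    linarith

/-- The Green function of the `n × n` grid, by separation of variables. -/
noncomputable def gridGreen (n : ℕ) (p q : ℤ × ℤ) : ℝ :=
  2 / ((n + 1 : ℕ) : ℝ) ^ 2 * ∑ k ∈ Finset.range (n + 1), ∑ l ∈ Finset.range (n + 1),
    sin (π * k / (n + 1 : ℕ) * p.1) * sin (π * l / (n + 1 : ℕ) * p.2) *
      (sin (π * k / (n + 1 : ℕ) * q.1) * sin (π * l / (n + 1 : ℕ) * q.2)) /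
      (2 - cos (π * k / (n + 1 : ℕ)) - cos (π * l / (n + 1 : ℕ)))

/-- Any real frequencies give an eigenfunction on the whole lattice; the choice πk/(n+1) matters
only for the boundary values and for orthogonality. -/
lemma sum_latticeNeighbors_sin_mul_sin (p : ℤ × ℤ) (a b : ℝ) :
    ∑ q ∈ latticeNeighbors p, (sin (a * p.1) * sin (b * p.2) - sin (a * q.1) * sin (b * q.2)) =
      2 * (2 - cos a - cos b) * (sin (a * p.1) * sin (b * p.2)) := by
  rw [sum_latticeNeighbors]
  push_cast
  simp only [mul_add, mul_sub, mul_one, sin_add, sin_sub]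
  ring

lemma gridGreen_eq_zero {n : ℕ} {p q : ℤ × ℤ}
    (h : p.1 = 0 ∨ p.1 = n + 1 ∨ p.2 = 0 ∨ p.2 = n + 1) : gridGreen n p q = 0 := by
  have key : ∀ (k : ℕ) (x : ℤ), x = 0 ∨ x = n + 1 → sin (π * k / (n + 1 : ℕ) * x) = 0 := by
    rintro k x (rfl | rfl)
    · simp
    · rw [show π * k / (n + 1 : ℕ) * ((n + 1 : ℤ) : ℝ) = k * π by push_cast; field_simp]
      exact sin_nat_mul_pi k
  unfold gridGreen
  refine mul_eq_zero_of_right _ (Finset.sum_eq_zero fun k _ => Finset.sum_eq_zero fun l _ => ?_)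
  rcases (or_assoc.2 h : (p.1 = 0 ∨ p.1 = n + 1) ∨ _) with h | h
  · rw [key k _ h]; simp
  · rw [key l _ h]; simp

lemma sum_latticeNeighbors_gridGreen {n : ℕ} {p q : ℤ × ℤ} (hp : p ∈ gridVertices n n)
    (hq : q ∈ gridVertices n n) :
    ∑ r ∈ latticeNeighbors p, (gridGreen n p q - gridGreen n r q) = if p = q then 1 else 0 := by
  have hp' := mem_gridVertices.1 hp
  have hq' := mem_gridVertices.1 hq
  simp only [gridGreen, ← mul_sub, ← Finset.sum_sub_distrib]
  rw [← Finset.mul_sum, Finset.sum_comm]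
  have h1 : ∀ k ∈ Finset.range (n + 1), ∀ l ∈ Finset.range (n + 1),
      ∑ r ∈ latticeNeighbors p,
        (sin (π * k / (n + 1 : ℕ) * p.1) * sin (π * l / (n + 1 : ℕ) * p.2) *
            (sin (π * k / (n + 1 : ℕ) * q.1) * sin (π * l / (n + 1 : ℕ) * q.2)) /
            (2 - cos (π * k / (n + 1 : ℕ)) - cos (π * l / (n + 1 : ℕ))) -
          sin (π * k / (n + 1 : ℕ) * r.1) * sin (π * l / (n + 1 : ℕ) * r.2) *
            (sin (π * k / (n + 1 : ℕ) * q.1) * sin (π * l / (n + 1 : ℕ) * q.2)) /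
            (2 - cos (π * k / (n + 1 : ℕ)) - cos (π * l / (n + 1 : ℕ)))) =
      2 * ((sin (π * k / (n + 1 : ℕ) * p.1) * sin (π * k / (n + 1 : ℕ) * q.1)) *
        (sin (π * l / (n + 1 : ℕ) * p.2) * sin (π * l / (n + 1 : ℕ) * q.2))) := by
    intro k hk l hl
    rw [Finset.mem_range] at hk hl
    simp only [← sub_div, ← sub_mul]
    rw [← Finset.sum_div, ← Finset.sum_mul, sum_latticeNeighbors_sin_mul_sin]
    by_cases h : k ≠ 0 ∨ l ≠ 0
    · have := two_sub_cos_sub_cos_ne_zero hk hl h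
      field_simp
    -- The zero mode has denominator 0, but its sines vanish, so both sides are 0. Ranges starting
    -- at 0 are thus harmless and match the Riemann sum nodes.
    · push Not at h
      simp [h.1]
  have h2 : ∀ k ∈ Finset.range (n + 1), _ := fun k hk =>
    Finset.sum_comm.trans (Finset.sum_congr rfl (h1 k hk))
  rw [Finset.sum_congr rfl h2]
  simp_rw [← Finset.mul_sum]
  rw [← Finset.sum_mul, sum_sin_mul_sin (by push_cast; omega) (by push_cast; omega),
    sum_sin_mul_sin (by push_cast; omega) (by push_cast; omega)]
  have hN : ((n + 1 : ℕ) : ℝ) ≠ 0 := by positivity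
  by_cases h3 : p.1 = q.1 <;> by_cases h4 : p.2 = q.2 <;> simp only [h3, h4, Prod.ext_iff, if_true,
    if_false, and_true, and_false, and_self, mul_zero, zero_mul]
  field_simp

lemma gridK_mul_gridGreen (n : ℕ) :
    gridK n n * Matrix.of (fun p q : gridVertices n n => gridGreen n p q) = 1 := by
  ext ⟨p, hp⟩ ⟨q, hq⟩
  have h := gridK_mulVec hp (fun r => gridGreen n r q)
  rw [Matrix.mul_apply]
  refine Eq.trans ?_ (h.trans ?_)
  · rfl
  · rw [Matrix.one_apply]
    refine Eq.trans (Finset.sum_congr rfl fun r hr => ?_)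
      ((sum_latticeNeighbors_gridGreen hp hq).trans (if_congr (by simp) rfl rfl))
    congr 1
    split_ifs with hr'
    · rfl
    · refine (gridGreen_eq_zero ?_).symm
      rw [mem_gridVertices] at hp hr'
      simp only [latticeNeighbors, Finset.mem_insert, Finset.mem_singleton, Prod.ext_iff] at hr
      omega

lemma isUnit_det_gridK (n : ℕ) : IsUnit (gridK n n).det :=
  Matrix.isUnit_det_of_right_inverse (gridK_mul_gridGreen n)

lemma gridA_eq_gridGreen {n : ℕ} {p q : ℤ × ℤ} (hp : p ∈ gridVertices n n)
    (hq : q ∈ gridVertices n n) : gridA n n p q = gridGreen n p q := by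
  rw [gridA, dif_pos ⟨hp, hq⟩, Matrix.inv_eq_right_inv (gridK_mul_gridGreen n)]
  rfl

lemma gridGreen_one_one (n : ℕ) (x y : ℤ) : gridGreen n (x, y) (1, 1) =
    2 / ((n + 1 : ℕ) : ℝ) ^ 2 * ∑ k ∈ Finset.range (n + 1), ∑ l ∈ Finset.range (n + 1),
      greenIntegrand x y (π * k / (n + 1 : ℕ), π * l / (n + 1 : ℕ)) := by
  simp only [gridGreen, greenIntegrand, Int.cast_one, mul_one]
  simp only [mul_assoc]

/-! ### Riemann sums on a square -/

lemma mul_div_mem_Icc {L : ℝ} (hL : 0 < L) {N k : ℕ} (hN : 0 < N) (hk : k ≤ N) :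
    L * k / N ∈ Icc 0 L := by
  have hN' : (0 : ℝ) < N := by exact_mod_cast hN
  refine ⟨by positivity, ?_⟩
  rw [div_le_iff₀ hN']
  gcongr

lemma abs_integral_sub_riemannSum_le {L ε : ℝ} (hL : 0 < L) {N : ℕ} (hN : 0 < N) {f : ℝ → ℝ}
    (hf : ContinuousOn f (Icc 0 L))
    (hmod : ∀ x ∈ Icc 0 L, ∀ y ∈ Icc 0 L, |x - y| ≤ L / N → |f x - f y| ≤ ε) :
    |(∫ x in 0..L, f x) - L / N * ∑ k ∈ Finset.range N, f (L * k / N)| ≤ L * ε := by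
  have hN' : (0 : ℝ) < N := by exact_mod_cast hN
  let a : ℕ → ℝ := fun k => L * k / N
  have hstep : ∀ k, a (k + 1) - a k = L / N := fun k => by simp only [a]; push_cast; ring
  have hle : ∀ k, a k ≤ a (k + 1) := fun k => by
    have h := hstep k
    have : 0 < L / N := by positivity
    linarith
  have ha : ∀ k, k < N → Icc (a k) (a (k + 1)) ⊆ Icc 0 L := fun k hk =>
    Icc_subset_Icc (mul_div_mem_Icc hL hN hk.le).1 (mul_div_mem_Icc hL hN hk).2
  have hint : ∀ k < N, IntervalIntegrable f volume (a k) (a (k + 1)) := fun k hk =>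
    ContinuousOn.intervalIntegrable (by rw [uIcc_of_le (hle k)]; exact hf.mono (ha k hk))
  have hsum := intervalIntegral.sum_integral_adjacent_intervals hint
  have ha0 : a 0 = 0 := by simp [a]
  have haN : a N = L := by simp only [a]; field_simp
  rw [ha0, haN] at hsum
  rw [← hsum, Finset.mul_sum, ← Finset.sum_sub_distrib]
  calc |∑ k ∈ Finset.range N, ((∫ x in a k..a (k + 1), f x) - L / N * f (L * k / N))|
      ≤ ∑ k ∈ Finset.range N, |(∫ x in a k..a (k + 1), f x) - L / N * f (L * k / N)| :=
        Finset.abs_sum_le_sum_abs _ _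
    _ ≤ ∑ _k ∈ Finset.range N, ε * (L / N) := by
        refine Finset.sum_le_sum fun k hk => ?_
        have hk' := Finset.mem_range.1 hk
        have h1 : (∫ x in a k..a (k + 1), f x) - L / N * f (L * k / N) =
            ∫ x in a k..a (k + 1), (f x - f (a k)) := by
          rw [intervalIntegral.integral_sub (hint k hk') intervalIntegrable_const,
            intervalIntegral.integral_const, hstep, smul_eq_mul]
        rw [h1]
        have h2 : ∀ x ∈ uIoc (a k) (a (k + 1)), ‖f x - f (a k)‖ ≤ ε := by
          intro x hx
          rw [uIoc_of_le (hle k)] at hx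
          refine hmod x (ha k hk' ⟨hx.1.le, hx.2⟩) (a k) (ha k hk' ⟨le_rfl, hle k⟩) ?_
          rw [abs_of_pos (sub_pos.2 hx.1), ← hstep k]
          linarith [hx.2]
        refine (intervalIntegral.norm_integral_le_of_norm_le_const h2).trans_eq ?_
        rw [hstep, abs_of_pos (by positivity)]
    _ = L * ε := by
        rw [Finset.sum_const, Finset.card_range, nsmul_eq_mul]
        field_simp

/-- By uniform continuity the inner integral inherits a modulus of continuity from `g`, so the
one-dimensional estimate applies in each variable in turn. -/
lemma tendsto_riemannSum_square {L : ℝ} (hL : 0 < L) {g : ℝ × ℝ → ℝ}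
    (hg : ContinuousOn g (Icc 0 L ×ˢ Icc 0 L)) :
    Tendsto (fun N : ℕ => (L / N) ^ 2 * ∑ k ∈ Finset.range N, ∑ l ∈ Finset.range N,
      g (L * k / N, L * l / N)) atTop (𝓝 (∫ x in 0..L, ∫ y in 0..L, g (x, y))) := by
  have huc := (isCompact_Icc.prod isCompact_Icc).uniformContinuousOn_of_continuous hg
  rw [Metric.uniformContinuousOn_iff] at huc
  have hsec : ∀ x ∈ Icc 0 L, ContinuousOn (fun y => g (x, y)) (Icc 0 L) := fun x hx =>
    hg.comp (by fun_prop) fun y hy => ⟨hx, hy⟩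
  have hinner : ∀ δ > 0, ∀ ε > 0, (∀ p ∈ Icc 0 L ×ˢ Icc 0 L, ∀ q ∈ Icc 0 L ×ˢ Icc 0 L,
      dist p q < δ → dist (g p) (g q) < ε) → ∀ x ∈ Icc 0 L, ∀ y ∈ Icc 0 L, |x - y| < δ →
      |(∫ t in 0..L, g (x, t)) - ∫ t in 0..L, g (y, t)| ≤ L * ε := by
    intro δ hδ ε hε h x hx y hy hxy
    rw [← intervalIntegral.integral_sub
      (ContinuousOn.intervalIntegrable (by rw [uIcc_of_le hL.le]; exact hsec x hx))
      (ContinuousOn.intervalIntegrable (by rw [uIcc_of_le hL.le]; exact hsec y hy))]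
    have h2 : ∀ t ∈ uIoc 0 L, ‖g (x, t) - g (y, t)‖ ≤ ε := by
      intro t ht
      rw [uIoc_of_le hL.le] at ht
      have ht' : t ∈ Icc 0 L := ⟨ht.1.le, ht.2⟩
      refine (h (x, t) ⟨hx, ht'⟩ (y, t) ⟨hy, ht'⟩ ?_).le
      rw [Prod.dist_eq]
      simpa [Real.dist_eq] using hxy
    refine (intervalIntegral.norm_integral_le_of_norm_le_const h2).trans_eq ?_
    rw [sub_zero, abs_of_pos hL, mul_comm]
  have houter : ContinuousOn (fun x => ∫ t in 0..L, g (x, t)) (Icc 0 L) := by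
    rw [Metric.continuousOn_iff]
    intro x hx ε hε
    obtain ⟨δ, hδ, h⟩ := huc (ε / (2 * L)) (by positivity)
    refine ⟨δ, hδ, fun y hy hxy => ?_⟩
    have := hinner δ hδ _ (by positivity) h y hy x hx hxy
    rw [Real.dist_eq]
    refine this.trans_lt ?_
    rw [show L * (ε / (2 * L)) = ε / 2 by field_simp]
    linarith
  rw [Metric.tendsto_atTop]
  intro ε hε
  -- The outer and the inner discretization each cost L²η = ε/4.
  obtain ⟨δ, hδ, h⟩ := huc (ε / (4 * L ^ 2)) (by positivity)
  set η := ε / (4 * L ^ 2) with hη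
  obtain ⟨N₀, hN₀⟩ := exists_nat_gt (L / δ)
  refine ⟨N₀ + 1, fun N hN => ?_⟩
  have hNpos : 0 < N := by omega
  have hN' : (0 : ℝ) < N := by exact_mod_cast hNpos
  have hstep : L / N < δ := by
    rw [div_lt_comm₀ hN' hδ]
    exact hN₀.trans_le (by exact_mod_cast (by omega : N₀ ≤ N))
  have h1 := abs_integral_sub_riemannSum_le hL hNpos houter (ε := L * η)
    (fun x hx y hy hxy => hinner δ hδ η (by positivity) h x hx y hy (hxy.trans_lt hstep))
  have h2 : ∀ k ∈ Finset.range N, |(∫ t in 0..L, g (L * k / N, t)) -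
      L / N * ∑ l ∈ Finset.range N, g (L * k / N, L * l / N)| ≤ L * η := by
    intro k hk
    have hx := mul_div_mem_Icc hL hNpos (Finset.mem_range.1 hk).le
    refine abs_integral_sub_riemannSum_le hL hNpos (hsec _ hx) fun x hx' y hy' hxy => ?_
    refine (h (_, x) ⟨hx, hx'⟩ (_, y) ⟨hx, hy'⟩ ?_).le
    rw [Prod.dist_eq]
    simpa [Real.dist_eq] using hxy.trans_lt hstep
  have h3 : |L / N * (∑ k ∈ Finset.range N, ∫ t in 0..L, g (L * k / N, t)) -
      (L / N) ^ 2 * ∑ k ∈ Finset.range N, ∑ l ∈ Finset.range N, g (L * k / N, L * l / N)| ≤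
      L * (L * η) := by
    rw [pow_two, mul_assoc, ← mul_sub, Finset.mul_sum, ← Finset.sum_sub_distrib, abs_mul,
      abs_of_pos (by positivity : 0 < L / N)]
    calc _ ≤ L / N * ∑ _k ∈ Finset.range N, L * η :=
          mul_le_mul_of_nonneg_left ((Finset.abs_sum_le_sum_abs _ _).trans
            (Finset.sum_le_sum h2)) (by positivity)
      _ = L * (L * η) := by
          rw [Finset.sum_const, Finset.card_range, nsmul_eq_mul]
          field_simp
  rw [dist_comm, Real.dist_eq]
  refine (abs_sub_le _ _ _).trans_lt ((add_le_add h1 h3).trans_lt ?_)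
  rw [show L * (L * η) + L * (L * η) = ε / 2 by rw [hη]; field_simp; ring]
  linarith

/-! ### The integrand of the Green function -/

lemma le_two_sub_cos_sub_cos {a b : ℝ} (ha : a ∈ Icc 0 π) (hb : b ∈ Icc 0 π) :
    2 / π ^ 2 * (a ^ 2 + b ^ 2) ≤ 2 - cos a - cos b := by
  have h1 := cos_le_one_sub_mul_cos_sq (x := a) (abs_le.2 ⟨by linarith [ha.1, pi_pos], ha.2⟩)
  have h2 := cos_le_one_sub_mul_cos_sq (x := b) (abs_le.2 ⟨by linarith [hb.1, pi_pos], hb.2⟩)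
  linarith

/-- sin a sin b ≤ ab ≤ (a²+b²)/2 is controlled by the denominator. The factor |sin(ax)| is kept
because it tends to 0 at the origin, which yields continuity there. -/
lemma abs_greenIntegrand_le (x y : ℤ) {z : ℝ × ℝ} (hz : z ∈ Icc 0 π ×ˢ Icc 0 π) :
    |greenIntegrand x y z| ≤ π ^ 2 / 4 * |sin (z.1 * x)| := by
  obtain ⟨a, b⟩ := z
  obtain ⟨ha, hb⟩ := hz
  simp only at ha hb
  have hd := le_two_sub_cos_sub_cos ha hb
  have hd0 : 0 ≤ 2 - cos a - cos b := le_trans (by positivity) hd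
  simp only [greenIntegrand]
  rw [abs_div, abs_of_nonneg hd0]
  refine div_le_of_le_mul₀ hd0 (by positivity) ?_
  rw [abs_mul, abs_mul, abs_mul, abs_of_nonneg (sin_nonneg_of_mem_Icc ha),
    abs_of_nonneg (sin_nonneg_of_mem_Icc hb)]
  have h1 := sin_le ha.1
  have h2 := sin_le hb.1
  have h3 := sin_nonneg_of_mem_Icc ha
  have h4 := sin_nonneg_of_mem_Icc hb
  have h5 := abs_sin_le_one (b * y)
  have h6 : sin a * sin b ≤ π ^ 2 / 4 * (2 - cos a - cos b) := by
    calc sin a * sin b ≤ a * b := mul_le_mul h1 h2 h4 ha.1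
      _ ≤ (a ^ 2 + b ^ 2) / 2 := by nlinarith [sq_nonneg (a - b)]
      _ = π ^ 2 / 4 * (2 / π ^ 2 * (a ^ 2 + b ^ 2)) := by field_simp; norm_num
      _ ≤ _ := by gcongr
  calc |sin (a * x)| * |sin (b * y)| * sin a * sin b
      = |sin (a * x)| * |sin (b * y)| * (sin a * sin b) := by ring
    _ ≤ |sin (a * x)| * 1 * (π ^ 2 / 4 * (2 - cos a - cos b)) := by gcongr
    _ = _ := by ring

lemma continuousOn_greenIntegrand (x y : ℤ) :
    ContinuousOn (greenIntegrand x y) (Icc 0 π ×ˢ Icc 0 π) := by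
  intro z hz
  by_cases h : 2 - cos z.1 - cos z.2 = 0
  -- The denominator vanishes only at the origin, where division by zero gives the value 0, which is
  -- also the limit.
  · have hd := le_two_sub_cos_sub_cos hz.1 hz.2
    rw [h] at hd
    have h0 : z.1 ^ 2 + z.2 ^ 2 ≤ 0 := by
      by_contra hc
      have : 0 < 2 / π ^ 2 * (z.1 ^ 2 + z.2 ^ 2) := by
        have := not_le.1 hc
        positivity
      linarith
    have h1 : z.1 = 0 := by nlinarith [sq_nonneg z.1, sq_nonneg z.2]
    have hv : greenIntegrand x y z = 0 := by simp [greenIntegrand, h]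
    rw [ContinuousWithinAt, hv]
    have hc : Tendsto (fun w : ℝ × ℝ => π ^ 2 / 4 * |sin (w.1 * x)|) (𝓝 z) (𝓝 0) := by
      have : Continuous fun w : ℝ × ℝ => π ^ 2 / 4 * |sin (w.1 * x)| := by fun_prop
      have h2 := this.tendsto z
      simpa [h1] using h2
    refine squeeze_zero_norm' ?_ (hc.mono_left nhdsWithin_le_nhds)
    filter_upwards [self_mem_nhdsWithin] with w hw
    exact abs_greenIntegrand_le x y hw
  · refine ContinuousAt.continuousWithinAt ?_
    unfold greenIntegrand
    exact ContinuousAt.div (by fun_prop) (by fun_prop) h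

lemma integrableOn_greenIntegrand (x y : ℤ) :
    IntegrableOn (greenIntegrand x y) (Ioo 0 π ×ˢ Ioo 0 π) volume :=
  ((continuousOn_greenIntegrand x y).integrableOn_compact
    (isCompact_Icc.prod isCompact_Icc)).mono_set
    (prod_mono Ioo_subset_Icc_self Ioo_subset_Icc_self)

lemma tendsto_gridA (x y : ℤ) (hx : 1 ≤ x) (hy : 1 ≤ y) :
    Tendsto (fun n : ℕ => gridA n n (x, y) (1, 1)) atTop
      (𝓝 (2 / π ^ 2 * ∫ z in Ioo 0 π ×ˢ Ioo 0 π, greenIntegrand x y z)) := by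
  have hI : ∫ z in Ioo 0 π ×ˢ Ioo 0 π, greenIntegrand x y z =
      ∫ a in 0..π, ∫ b in 0..π, greenIntegrand x y (a, b) := by
    rw [Measure.volume_eq_prod, setIntegral_prod _ (integrableOn_greenIntegrand x y)]
    simp only [intervalIntegral.integral_of_le pi_pos.le, integral_Ioc_eq_integral_Ioo]
  rw [hI]
  -- The mesh is π/N with N = n+1, and 2/N² = (2/π²)(π/N)².
  have h := ((tendsto_riemannSum_square pi_pos (continuousOn_greenIntegrand x y)).comp
    (tendsto_add_atTop_nat 1)).const_mul (2 / π ^ 2)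
  refine h.congr' ?_
  filter_upwards [eventually_ge_atTop (max x y).toNat] with n hn
  have h1 : (x, y) ∈ gridVertices n n := by rw [mem_gridVertices]; simp only; omega
  have h2 : ((1, 1) : ℤ × ℤ) ∈ gridVertices n n := by rw [mem_gridVertices]; simp only; omega
  rw [gridA_eq_gridGreen h1 h2, gridGreen_one_one]
  simp only [Function.comp]
  rw [← mul_assoc]
  congr 1
  field_simp

/-! ### Sums of the Green function over the grid -/

lemma sum_Icc_int_eq_sum_range (n : ℕ) (f : ℤ → ℝ) (h0 : f 0 = 0) :
    ∑ x ∈ Finset.Icc 1 (n : ℤ), f x = ∑ k ∈ Finset.range (n + 1), f k := by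
  induction n with
  | zero => simp [h0]
  | succ n ih =>
    rw [Finset.sum_range_succ, ← ih]
    have : Finset.Icc 1 ((n + 1 : ℕ) : ℤ) = insert ((n + 1 : ℕ) : ℤ) (Finset.Icc 1 (n : ℤ)) := by
      ext x
      simp only [Finset.mem_Icc, Finset.mem_insert]
      omega
    rw [this, Finset.sum_insert (by simp), add_comm]

/-- With α = πk/(n+1), the sine sum is cot(α/2) for odd k and 0 for even k; multiplying by sin α
gives 2cos²(α/2) in the odd case. -/
lemma sum_sin_mul_sin_self {n k : ℕ} (hk : k < n + 1) :
    (∑ x ∈ Finset.Icc 1 (n : ℤ), sin (π * k / (n + 1 : ℕ) * x)) * sin (π * k / (n + 1 : ℕ)) =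
      if Odd k then 1 + cos (π * k / (n + 1 : ℕ)) else 0 := by
  rcases Nat.eq_zero_or_pos k with rfl | hk0
  · simp
  set α := π * k / (n + 1 : ℕ) with hα
  rw [sum_Icc_int_eq_sum_range n (fun x => sin (α * x)) (by simp)]
  simp only [Int.cast_natCast]
  simp_rw [mul_comm α]
  have h1 := two_mul_sin_mul_sum_sin (n + 1) α
  have h2 : ((n + 1 : ℕ) - 1 / 2 : ℝ) * α = k * π - α / 2 := by
    rw [hα]; field_simp
  rw [h2, cos_sub, sin_nat_mul_pi, cos_nat_mul_pi] at h1
  have h3 : sin α = 2 * sin (α / 2) * cos (α / 2) := by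
    rw [← sin_two_mul]; congr 1; ring
  have h4 : 1 + cos α = 2 * cos (α / 2) ^ 2 := by
    rw [cos_sq]; ring_nf
  rw [h3, h4]
  split_ifs with ho
  · rw [ho.neg_one_pow] at h1
    linear_combination cos (α / 2) * h1
  · rw [(Nat.not_odd_iff_even.1 ho).neg_one_pow] at h1
    linear_combination cos (α / 2) * h1

lemma sum_range_ite_odd (N : ℕ) (f : ℕ → ℝ) :
    ∑ k ∈ Finset.range N, (if Odd k then f k else 0) =
      ∑ i ∈ Finset.range (N / 2), f (2 * i + 1) := by
  have key : ∀ M : ℕ, ∑ k ∈ Finset.range (2 * M), (if Odd k then f k else 0) =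
      ∑ i ∈ Finset.range M, f (2 * i + 1) := by
    intro M
    induction M with
    | zero => simp
    | succ M ih =>
      rw [mul_add, mul_one, Finset.sum_range_succ, Finset.sum_range_succ, ih,
        Finset.sum_range_succ]
      simp
  rcases Nat.even_or_odd' N with ⟨M, rfl | rfl⟩
  · rw [key, Nat.mul_div_cancel_left _ two_pos]
  · rw [Finset.sum_range_succ, key, show (2 * M + 1) / 2 = M by omega]
    simp

lemma sum_gridA (n : ℕ) (hn : 1 ≤ n) : ∑ p ∈ gridVertices n n, gridA n n p (1, 1) =
    2 / ((n + 1 : ℕ) : ℝ) ^ 2 * ∑ i ∈ Finset.range ((n + 1) / 2), ∑ j ∈ Finset.range ((n + 1) / 2),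
      (1 + cos (π * (2 * i + 1 : ℕ) / (n + 1 : ℕ))) * (1 + cos (π * (2 * j + 1 : ℕ) / (n + 1 : ℕ))) /
        (2 - cos (π * (2 * i + 1 : ℕ) / (n + 1 : ℕ)) - cos (π * (2 * j + 1 : ℕ) / (n + 1 : ℕ))) := by
  have hc : ((1, 1) : ℤ × ℤ) ∈ gridVertices n n := by rw [mem_gridVertices]; simp only; omega
  let θ : ℕ → ℝ := fun k => π * k / (n + 1 : ℕ)
  have h1 : ∀ k ∈ Finset.range (n + 1), ∀ l ∈ Finset.range (n + 1),
      ∑ p ∈ gridVertices n n, greenIntegrand p.1 p.2 (θ k, θ l) =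
      if Odd k then (if Odd l then (1 + cos (θ k)) * (1 + cos (θ l)) /
        (2 - cos (θ k) - cos (θ l)) else 0) else 0 := by
    intro k hk l hl
    have e1 := sum_sin_mul_sin_self (Finset.mem_range.1 hk)
    have e2 := sum_sin_mul_sin_self (Finset.mem_range.1 hl)
    have e3 : ∑ p ∈ gridVertices n n, greenIntegrand p.1 p.2 (θ k, θ l) =
        ((∑ x ∈ Finset.Icc 1 (n : ℤ), sin (θ k * x)) * sin (θ k)) *
        ((∑ y ∈ Finset.Icc 1 (n : ℤ), sin (θ l * y)) * sin (θ l)) /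
        (2 - cos (θ k) - cos (θ l)) := by
      simp only [greenIntegrand]
      rw [← Finset.sum_div, gridVertices, Finset.sum_product]
      congr 1
      rw [mul_mul_mul_comm, Finset.sum_mul_sum, Finset.sum_mul]
      refine Finset.sum_congr rfl fun x _ => ?_
      rw [Finset.sum_mul]
      refine Finset.sum_congr rfl fun y _ => ?_
      ring
    rw [e3, e1, e2]
    split_ifs <;> simp [θ]
  rw [Finset.sum_congr rfl fun p hp => (gridA_eq_gridGreen hp hc).trans
    (gridGreen_one_one n p.1 p.2), ← Finset.mul_sum, Finset.sum_comm]
  congr 1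
  rw [← sum_range_ite_odd (n + 1) fun k => ∑ j ∈ Finset.range ((n + 1) / 2),
    (1 + cos (θ k)) * (1 + cos (θ (2 * j + 1))) / (2 - cos (θ k) - cos (θ (2 * j + 1)))]
  refine Finset.sum_congr rfl fun k hk => ?_
  rw [Finset.sum_comm, Finset.sum_congr rfl fun l hl => h1 k hk l hl]
  split_ifs
  · exact sum_range_ite_odd (n + 1) fun l => (1 + cos (θ k)) * (1 + cos (θ l)) /
      (2 - cos (θ k) - cos (θ l))
  · simp

/-! ### Asymptotics of the double sum -/

lemma half_sq_sub_one_sub_cos_le {x : ℝ} (hx : 0 ≤ x) :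
    x ^ 2 / 2 - (1 - cos x) ≤ x ^ 4 / 2 := by
  rcases le_total x 1 with h | h
  · have h1 := (abs_le.1 (cos_bound (x := x) (by rwa [abs_of_nonneg hx]))).2
    rw [abs_of_nonneg hx] at h1
    nlinarith [pow_nonneg hx 4]
  · have h1 := cos_le_one x
    nlinarith [mul_self_nonneg x, one_le_pow₀ h (n := 2)]

/-- With A = 1−cos a, B = 1−cos b and s = A+B, the numerator is 4−2s+AB. Here AB/s lies in [0,2],
and 4/s−8/(a²+b²) is bounded because s agrees with (a²+b²)/2 up to fourth order. -/
lemma abs_cos_ratio_sub_le {a b : ℝ} (ha : a ∈ Ioo 0 π) (hb : b ∈ Ioo 0 π) :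
    |(1 + cos a) * (1 + cos b) / (2 - cos a - cos b) - 8 / (a ^ 2 + b ^ 2)| ≤ 2 * π ^ 2 + 2 := by
  have hd := le_two_sub_cos_sub_cos (Ioo_subset_Icc_self ha) (Ioo_subset_Icc_self hb)
  have hr : 0 < a ^ 2 + b ^ 2 := by have := ha.1; positivity
  have hπ := pi_pos
  set s := 2 - cos a - cos b with hs
  set r := a ^ 2 + b ^ 2 with hrdef
  have hs0 : 0 < s := lt_of_lt_of_le (by positivity) hd
  have e : (1 + cos a) * (1 + cos b) / s - 8 / r =
      8 * (r / 2 - s) / (s * r) - 2 + (1 - cos a) * (1 - cos b) / s := by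
    field_simp
    rw [hs]
    ring
  have h1 : 0 ≤ r / 2 - s := by
    have := one_sub_sq_div_two_le_cos (x := a)
    have := one_sub_sq_div_two_le_cos (x := b)
    rw [hs, hrdef]; linarith
  have h2 : r / 2 - s ≤ r ^ 2 / 2 := by
    have := half_sq_sub_one_sub_cos_le ha.1.le
    have := half_sq_sub_one_sub_cos_le hb.1.le
    have : 0 ≤ a ^ 2 * b ^ 2 := by positivity
    rw [hs, hrdef]; nlinarith
  have h3 : 8 * (r / 2 - s) / (s * r) ≤ 2 * π ^ 2 := by
    rw [div_le_iff₀ (by positivity)]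
    have h4 : 2 * r ≤ π ^ 2 * s := by
      calc 2 * r = π ^ 2 * (2 / π ^ 2 * r) := by field_simp
        _ ≤ _ := by gcongr
    nlinarith
  have h3' : 0 ≤ 8 * (r / 2 - s) / (s * r) := by positivity
  have hu := cos_le_one a
  have hv := cos_le_one b
  have hu' := neg_one_le_cos a
  have hv' := neg_one_le_cos b
  have h5 : 0 ≤ (1 - cos a) * (1 - cos b) / s :=
    div_nonneg (mul_nonneg (by linarith) (by linarith)) hs0.le
  have h6 : (1 - cos a) * (1 - cos b) / s ≤ 2 := by
    rw [div_le_iff₀ hs0, hs]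
    nlinarith
  rw [e, abs_le]
  constructor <;> nlinarith

lemma arctan_sub_arctan_bounds {u v : ℝ} (hu : 0 ≤ u) (huv : u ≤ v) :
    (v - u) / (1 + v ^ 2) ≤ arctan v - arctan u ∧ arctan v - arctan u ≤ (v - u) / (1 + u ^ 2) := by
  rcases huv.eq_or_lt with rfl | huv
  · simp
  obtain ⟨c, hc, h⟩ := exists_hasDerivAt_eq_slope arctan (fun x => 1 / (1 + x ^ 2)) huv
    continuous_arctan.continuousOn fun x _ => hasDerivAt_arctan x
  have h' : arctan v - arctan u = (v - u) / (1 + c ^ 2) := by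
    have : v - u ≠ 0 := (sub_pos.2 huv).ne'
    field_simp at h
    field_simp
    linarith
  have hvu := (sub_pos.2 huv).le
  have hc0 : 0 ≤ c := hu.trans hc.1.le
  rw [h']
  constructor
  · have := hc.2.le
    gcongr
  · have := hc.1.le
    gcongr

lemma arctan_le_self {x : ℝ} (hx : 0 ≤ x) : arctan x ≤ x := by
  simpa using (arctan_sub_arctan_bounds le_rfl hx).2

/-- Integral comparison with step 2: arctan(t/c)/c is a primitive of 1/(c²+t²), and half of its
total increase π/(2c) is π/(4c). The 1/c² covers the loss near t = 0, the other error the tail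
beyond 2M+1. -/
lemma abs_sum_inv_sq_add_sq_sub_le {c : ℝ} (hc : 1 ≤ c) (M : ℕ) :
    |∑ j ∈ Finset.range M, 1 / (c ^ 2 + (2 * j + 1 : ℝ) ^ 2) - π / 4 / c| ≤
      1 / c ^ 2 + 1 / (2 * M + 1) / 2 := by
  have hc0 : 0 < c := by linarith
  have hstep : ∀ j : ℕ,
      2 * c * (1 / (c ^ 2 + (2 * (j + 1 : ℕ) + 1 : ℝ) ^ 2)) ≤
        arctan ((2 * (j + 1 : ℕ) + 1) / c) - arctan ((2 * j + 1) / c) ∧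
      arctan ((2 * (j + 1 : ℕ) + 1) / c) - arctan ((2 * j + 1) / c) ≤
        2 * c * (1 / (c ^ 2 + (2 * j + 1 : ℝ) ^ 2)) := by
    intro j
    obtain ⟨h1, h2⟩ := arctan_sub_arctan_bounds (u := (2 * j + 1) / c)
      (v := (2 * (j + 1 : ℕ) + 1) / c) (by positivity) (by push_cast; gcongr; linarith)
    have e : ∀ t : ℝ, ((2 * (j + 1 : ℕ) + 1) / c - (2 * j + 1) / c) / (1 + (t / c) ^ 2) =
        2 * c * (1 / (c ^ 2 + t ^ 2)) := by
      intro t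
      push_cast
      field_simp
      ring
    rw [e] at h1 h2
    exact ⟨h1, h2⟩
  have hlow : arctan ((2 * M + 1) / c) - arctan (1 / c) ≤
      2 * c * ∑ j ∈ Finset.range M, 1 / (c ^ 2 + (2 * j + 1 : ℝ) ^ 2) := by
    have := Finset.sum_range_sub (fun j : ℕ => arctan ((2 * j + 1) / c)) M
    simp only [Nat.cast_zero, mul_zero, zero_add] at this
    rw [← this, Finset.mul_sum]
    exact Finset.sum_le_sum fun j _ => (hstep j).2
  have hup : 2 * c * ∑ j ∈ Finset.range M, 1 / (c ^ 2 + (2 * j + 1 : ℝ) ^ 2) ≤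
      2 * c * (1 / c ^ 2) + π / 2 := by
    have h0 : 2 * c * (1 / (c ^ 2 + (2 * (0 : ℕ) + 1 : ℝ) ^ 2)) ≤ 2 * c * (1 / c ^ 2) := by
      gcongr
      exact le_add_of_nonneg_right (by positivity)
    rcases M with _ | M
    · simp only [Finset.range_zero, Finset.sum_empty, mul_zero]
      positivity
    · rw [Finset.sum_range_succ', mul_add, add_comm]
      refine add_le_add h0 ?_
      have h1 := Finset.sum_range_sub (fun j : ℕ => arctan ((2 * j + 1) / c)) M
      rw [Finset.mul_sum]
      refine (Finset.sum_le_sum fun j _ => (hstep j).1).trans (h1.trans_le ?_)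
      have h2 := (arctan_lt_pi_div_two ((2 * M + 1) / c)).le
      have h3 : 0 ≤ arctan ((2 * (0 : ℕ) + 1) / c) := arctan_nonneg.2 (by positivity)
      linarith
  have hM : (0 : ℝ) < 2 * M + 1 := by positivity
  have h1 : arctan ((2 * M + 1) / c) = π / 2 - arctan (c / (2 * M + 1)) := by
    rw [← inv_div c, arctan_inv_of_pos (by positivity)]
  have h2 := arctan_le_self (x := c / (2 * M + 1)) (by positivity)
  have h3 := arctan_le_self (x := 1 / c) (by positivity)
  rw [h1] at hlow
  set T := ∑ j ∈ Finset.range M, 1 / (c ^ 2 + (2 * j + 1 : ℝ) ^ 2)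
  have e0 : 2 * c * (π / 4 / c) = π / 2 := by field_simp; norm_num
  have e1 : 2 * c * (1 / c ^ 2) = 2 * (1 / c) := by field_simp
  have e2 : 2 * c * (1 / (2 * M + 1) / 2 : ℝ) = c / (2 * M + 1) := by field_simp
  have h4 : 0 < 1 / c := by positivity
  have h5 : 0 ≤ c / (2 * M + 1 : ℝ) := by positivity
  rw [abs_le]
  constructor
  · refine le_of_mul_le_mul_left ?_ (by positivity : 0 < 2 * c)
    rw [mul_neg, mul_sub, mul_add, e0, e1, e2]
    linarith
  · refine le_of_mul_le_mul_left ?_ (by positivity : 0 < 2 * c)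
    rw [mul_add, mul_sub, e0, e2]
    linarith

/-- Telescoping majorant 2/(2i+1) − 2/(2i+3); a numerator of at least 3/2 is needed for the term i =
0. -/
lemma sum_inv_odd_sq_le (M : ℕ) :
    ∑ i ∈ Finset.range M, 1 / (2 * i + 1 : ℝ) ^ 2 ≤ 2 - 2 / (2 * M + 1 : ℝ) := by
  induction M with
  | zero => simp
  | succ M ih =>
    rw [Finset.sum_range_succ]
    have h : 1 / (2 * M + 1 : ℝ) ^ 2 ≤ 2 / (2 * M + 1) - 2 / (2 * (M + 1 : ℕ) + 1) := by
      push_cast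
      rw [div_sub_div _ _ (by positivity) (by positivity), div_le_div_iff₀ (by positivity)
        (by positivity)]
      have h0 : (0 : ℝ) ≤ M := Nat.cast_nonneg M
      nlinarith [pow_nonneg h0 2, pow_nonneg h0 3]
    linarith

lemma abs_double_sum_sub_le (M : ℕ) :
    |∑ i ∈ Finset.range M, ∑ j ∈ Finset.range M,
        1 / ((2 * i + 1 : ℝ) ^ 2 + (2 * j + 1 : ℝ) ^ 2) -
      π / 4 * ∑ i ∈ Finset.range M, 1 / (2 * i + 1 : ℝ)| ≤ 9 / 4 := by
  rw [Finset.mul_sum, ← Finset.sum_sub_distrib]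
  have hi : ∀ i ∈ Finset.range M, |∑ j ∈ Finset.range M,
      1 / ((2 * i + 1 : ℝ) ^ 2 + (2 * j + 1 : ℝ) ^ 2) - π / 4 * (1 / (2 * i + 1))| ≤
      1 / (2 * i + 1 : ℝ) ^ 2 + 1 / (2 * M + 1) / 2 := by
    intro i _
    rw [mul_one_div]
    refine abs_sum_inv_sq_add_sq_sub_le ?_ M
    have : (0 : ℝ) ≤ i := Nat.cast_nonneg i
    linarith
  refine ((Finset.abs_sum_le_sum_abs _ _).trans (Finset.sum_le_sum hi)).trans ?_
  rw [Finset.sum_add_distrib, Finset.sum_const, Finset.card_range, nsmul_eq_mul]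
  have h1 := sum_inv_odd_sq_le M
  have h2 : (0 : ℝ) ≤ 2 / (2 * M + 1) := by positivity
  have h3 : (M : ℝ) * (1 / (2 * M + 1) / 2) ≤ 1 / 4 := by
    rw [div_div, mul_one_div, div_le_iff₀ (by positivity)]
    linarith
  linarith

/-- log t ≤ t−1, applied to the ratio of consecutive odd numbers and to its inverse, traps each log
increment between consecutive terms of the doubled sum. -/
lemma abs_sum_inv_odd_sub_le (M : ℕ) :
    |∑ i ∈ Finset.range M, 1 / (2 * i + 1 : ℝ) - log (2 * M + 1) / 2| ≤ 1 := by
  have hstep : ∀ i : ℕ, 2 * (1 / (2 * (i + 1 : ℕ) + 1 : ℝ)) ≤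
        log (2 * (i + 1 : ℕ) + 1) - log (2 * i + 1) ∧
      log (2 * (i + 1 : ℕ) + 1) - log (2 * i + 1) ≤ 2 * (1 / (2 * i + 1 : ℝ)) := by
    intro i
    have hpos : (0 : ℝ) < 2 * i + 1 := by positivity
    have hpos' : (0 : ℝ) < 2 * (i + 1 : ℕ) + 1 := by positivity
    constructor
    · have h := log_le_sub_one_of_pos (div_pos hpos hpos')
      rw [log_div hpos.ne' hpos'.ne'] at h
      have e : (2 * i + 1) / (2 * (i + 1 : ℕ) + 1) - 1 = -(2 * (1 / (2 * (i + 1 : ℕ) + 1 : ℝ))) := by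
        field_simp; push_cast; ring
      linarith
    · have h := log_le_sub_one_of_pos (div_pos hpos' hpos)
      rw [log_div hpos'.ne' hpos.ne'] at h
      have e : (2 * (i + 1 : ℕ) + 1) / (2 * i + 1) - 1 = 2 * (1 / (2 * i + 1 : ℝ)) := by
        field_simp; push_cast; ring
      linarith
  have htel : ∀ M : ℕ, ∑ i ∈ Finset.range M,
      (log (2 * (i + 1 : ℕ) + 1) - log (2 * i + 1)) = log (2 * M + 1) := fun M => by
    rw [Finset.sum_range_sub (fun i : ℕ => log (2 * i + 1))]
    simp
  have h1 : log (2 * M + 1) ≤ 2 * ∑ i ∈ Finset.range M, 1 / (2 * i + 1 : ℝ) := by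
    rw [← htel, Finset.mul_sum]
    exact Finset.sum_le_sum fun i _ => (hstep i).2
  have h2 : 2 * ∑ i ∈ Finset.range M, 1 / (2 * i + 1 : ℝ) ≤ 2 + log (2 * M + 1) := by
    rcases M with _ | M
    · simp
    · rw [Finset.sum_range_succ', mul_add, add_comm]
      refine add_le_add (by simp) ?_
      have h3 := (hstep M).1
      have h4 : (0 : ℝ) ≤ 2 * (1 / (2 * (M + 1 : ℕ) + 1 : ℝ)) := by positivity
      have h5 := htel M
      rw [Finset.mul_sum]
      refine (Finset.sum_le_sum fun i _ => (hstep i).1).trans ?_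
      linarith
  rw [abs_le]
  constructor <;> linarith

lemma abs_log_sub_log_le {n : ℕ} (hn : 1 ≤ n) :
    |log (2 * ((n + 1) / 2 : ℕ) + 1) - log n| ≤ 2 := by
  have hn' : (1 : ℝ) ≤ n := by exact_mod_cast hn
  have hlo : (n : ℝ) ≤ 2 * ((n + 1) / 2 : ℕ) + 1 := by
    exact_mod_cast (by omega : n ≤ 2 * ((n + 1) / 2) + 1)
  have hhi : (2 * ((n + 1) / 2 : ℕ) + 1 : ℝ) ≤ n + 2 := by
    exact_mod_cast (by omega : 2 * ((n + 1) / 2) + 1 ≤ n + 2)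
  have h1 : log n ≤ log (2 * ((n + 1) / 2 : ℕ) + 1) := log_le_log (by linarith) hlo
  have h2 := log_le_sub_one_of_pos
    (div_pos (by positivity : (0 : ℝ) < 2 * ((n + 1) / 2 : ℕ) + 1) (by linarith : (0 : ℝ) < n))
  rw [log_div (by positivity) (by linarith)] at h2
  have h3 : (2 * ((n + 1) / 2 : ℕ) + 1 : ℝ) / n ≤ 3 := by
    rw [div_le_iff₀ (by linarith)]
    linarith
  rw [abs_of_nonneg (by linarith)]
  linarith

/-- At most N² terms, N = n+1, each have bounded error and carry weight 2/N². Rescaling 8/(a²+b²) by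
the mesh π/N produces 16/π². -/
lemma abs_sum_gridA_sub_le {n : ℕ} (hn : 1 ≤ n) :
    |∑ p ∈ gridVertices n n, gridA n n p (1, 1) -
      16 / π ^ 2 * ∑ i ∈ Finset.range ((n + 1) / 2), ∑ j ∈ Finset.range ((n + 1) / 2),
        1 / ((2 * i + 1 : ℝ) ^ 2 + (2 * j + 1 : ℝ) ^ 2)| ≤ 2 * (2 * π ^ 2 + 2) := by
  rw [sum_gridA n hn]
  set M := (n + 1) / 2 with hM
  set N : ℝ := ((n + 1 : ℕ) : ℝ) with hN
  have hN0 : 0 < N := by positivity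
  have hMN : (M : ℝ) ≤ N := by rw [hN]; exact_mod_cast (by omega : M ≤ n + 1)
  have e : 16 / π ^ 2 * ∑ i ∈ Finset.range M, ∑ j ∈ Finset.range M,
        1 / ((2 * i + 1 : ℝ) ^ 2 + (2 * j + 1 : ℝ) ^ 2) =
      2 / N ^ 2 * ∑ i ∈ Finset.range M, ∑ j ∈ Finset.range M,
        8 / ((π * (2 * i + 1 : ℕ) / N) ^ 2 + (π * (2 * j + 1 : ℕ) / N) ^ 2) := by
    simp only [Finset.mul_sum]
    refine Finset.sum_congr rfl fun i _ => Finset.sum_congr rfl fun j _ => ?_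
    push_cast
    field_simp
    norm_num
  rw [e, ← mul_sub, ← Finset.sum_sub_distrib, abs_mul, abs_of_pos (by positivity)]
  simp only [← Finset.sum_sub_distrib]
  have hmem : ∀ i ∈ Finset.range M, π * (2 * i + 1 : ℕ) / N ∈ Ioo 0 π := by
    intro i hi
    have hi' := Finset.mem_range.1 hi
    refine ⟨by positivity, ?_⟩
    rw [div_lt_iff₀ hN0]
    have : ((2 * i + 1 : ℕ) : ℝ) < N := by
      rw [hN]; exact_mod_cast (by omega : 2 * i + 1 < n + 1)
    gcongr
  have hb : |∑ i ∈ Finset.range M, ∑ j ∈ Finset.range M,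
      ((1 + cos (π * (2 * i + 1 : ℕ) / N)) * (1 + cos (π * (2 * j + 1 : ℕ) / N)) /
        (2 - cos (π * (2 * i + 1 : ℕ) / N) - cos (π * (2 * j + 1 : ℕ) / N)) -
        8 / ((π * (2 * i + 1 : ℕ) / N) ^ 2 + (π * (2 * j + 1 : ℕ) / N) ^ 2))| ≤
      M * (M * (2 * π ^ 2 + 2)) := by
    refine ((Finset.abs_sum_le_sum_abs _ _).trans (Finset.sum_le_sum fun i hi =>
      (Finset.abs_sum_le_sum_abs _ _).trans (Finset.sum_le_sum fun j hj =>
        abs_cos_ratio_sub_le (hmem i hi) (hmem j hj)))).trans_eq ?_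
    simp only [Finset.sum_const, Finset.card_range, nsmul_eq_mul]
  refine (mul_le_mul_of_nonneg_left hb (by positivity)).trans ?_
  have hC : 0 ≤ 2 * π ^ 2 + 2 := by positivity
  calc 2 / N ^ 2 * (M * (M * (2 * π ^ 2 + 2))) ≤ 2 / N ^ 2 * (N * (N * (2 * π ^ 2 + 2))) := by
        gcongr
    _ = 2 * (2 * π ^ 2 + 2) := by field_simp

lemma isEquivalent_sum_gridA :
    Asymptotics.IsEquivalent atTop
      (fun n : ℕ => ∑ p ∈ gridVertices n n, gridA n n p (1, 1))
      (fun n : ℕ => 2 / π * Real.log n) := by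
  have hπ := pi_pos
  have hbound : ∀ n : ℕ, 1 ≤ n →
      |∑ p ∈ gridVertices n n, gridA n n p (1, 1) - 2 / π * log n| ≤
        2 * (2 * π ^ 2 + 2) + (16 / π ^ 2 * (9 / 4) + 4 / π * 2) := by
    intro n hn
    have h1 := abs_sum_gridA_sub_le hn
    have h2 := abs_double_sum_sub_le ((n + 1) / 2)
    have h3 := abs_sum_inv_odd_sub_le ((n + 1) / 2)
    have h4 := abs_log_sub_log_le hn
    set S := ∑ p ∈ gridVertices n n, gridA n n p (1, 1)
    set D := ∑ i ∈ Finset.range ((n + 1) / 2), ∑ j ∈ Finset.range ((n + 1) / 2),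
        1 / ((2 * i + 1 : ℝ) ^ 2 + (2 * j + 1 : ℝ) ^ 2)
    set H := ∑ i ∈ Finset.range ((n + 1) / 2), 1 / (2 * i + 1 : ℝ)
    set l := log (2 * ((n + 1) / 2 : ℕ) + 1)
    have h5 : |H - log n / 2| ≤ 2 := by
      rw [abs_le] at h3 h4 ⊢
      constructor <;> linarith [h3.1, h3.2, h4.1, h4.2]
    -- 16/π² · π/4 = 4/π is the coefficient of the odd harmonic sum, which contributes (log n)/2.
    have e : S - 2 / π * log n = (S - 16 / π ^ 2 * D) +
        (16 / π ^ 2 * (D - π / 4 * H) + 4 / π * (H - log n / 2)) := by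
      field_simp
      ring
    rw [e]
    refine (abs_add_le _ _).trans (add_le_add h1 ((abs_add_le _ _).trans (add_le_add ?_ ?_)))
    · rw [abs_mul, abs_of_pos (by positivity)]
      gcongr
    · rw [abs_mul, abs_of_pos (by positivity)]
      gcongr
  refine Asymptotics.IsBigO.trans_isLittleO (g := fun _ => (1 : ℝ)) ?_ ?_
  · refine Asymptotics.IsBigO.of_bound (2 * (2 * π ^ 2 + 2) + (16 / π ^ 2 * (9 / 4) + 4 / π * 2)) ?_
    filter_upwards [eventually_ge_atTop 1] with n hn
    simpa using hbound n hn
  · rw [Asymptotics.isLittleO_one_left_iff]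
    have h : Tendsto (fun n : ℕ => 2 / π * Real.log n) atTop atTop :=
      (tendsto_log_atTop.comp tendsto_natCast_atTop_atTop).const_mul_atTop (by positivity)
    exact tendsto_norm_atTop_atTop.comp h

theorem mainTheorem4 :
    (∀ n : ℕ, 1 ≤ n → IsUnit (gridK n n).det) ∧
    (∀ x y : ℤ, 1 ≤ x → 1 ≤ y →
      IntegrableOn (greenIntegrand x y) (Ioo 0 π ×ˢ Ioo 0 π) volume ∧
      Tendsto (fun n : ℕ => gridA n n (x, y) (1, 1)) atTop
        (𝓝 (2 / π ^ 2 * ∫ z in Ioo 0 π ×ˢ Ioo 0 π, greenIntegrand x y z))) ∧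
    (∀ n : ℕ, 1 ≤ n →
      expectedTILength n n = ∑ p ∈ gridVertices n n, gridA n n p (1, 1)) ∧
    Asymptotics.IsEquivalent atTop (fun n : ℕ => expectedTILength n n)
      (fun n : ℕ => 2 / π * Real.log n) := by
  have hE : ∀ n : ℕ, 1 ≤ n →
      expectedTILength n n = ∑ p ∈ gridVertices n n, gridA n n p (1, 1) := fun n hn =>
    expectedTILength_eq_sum_gridA hn hn (isUnit_det_gridK n)
  refine ⟨fun n _ => isUnit_det_gridK n, fun x y hx hy => ⟨integrableOn_greenIntegrand x y,
    tendsto_gridA x y hx hy⟩, hE, isEquivalent_sum_gridA.congr_left ?_⟩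
  filter_upwards [eventually_ge_atTop 1] with n hn
  exact (hE n hn).symm
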